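/- Let $k$ be a ring (associative, with unit, not necessarily commutative; modules are left modules). A topological space is called *simply connected* if it is connected (in particular non-empty) and every covering of it is trivial, and *locally simply connected* if its simply connected open subsets form a basis of the topology. A *universal covering* is a covering whose total space is simply connected. A sheaf of $k$-modules $F$ on $X$ is *quasi-coherent* if every point of $X$ has an open neighbourhood $U$ on which there is an exact sequence of sheaves $k_U^{\oplus I}\to k_U^{\oplus J}\to F|_U\to 0$ for some sets $I,J$, where $k_U$ is the constant sheaf; $\operatorname{Qcoh}_k(X)$ is the full subcategory of quasi-coherent sheaves in the category of sheaves of $k$-modules on $X$. For a group $G$, $\operatorname{Mod}_k(G)$ is the category of $k$-modules with an action of $G$ by $k$-linear automorphisms. **Theorem.** Let $X$ be a connected and locally simply connected topological space, $\phi\colon\widetilde X\to X$ a universal covering, and $G=\operatorname{Aut}_X\widetilde X$. Then there is an equivalence of categories $$\operatorname{Qcoh}_k(X)\simeq\operatorname{Mod}_k(G).$$ It is given by the functor $\mathcal L\mapsto\Gamma(\widetilde X,\phi^{-1}\mathcal L)$, where $g\in G$ acts on sections by pulling them back along $g^{-1}$ (using $\phi\circ g^{-1}=\phi$). A quasi-inverse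 is the functor sending $E$ to the sheaf of continuous sections of $(\widetilde X\times E)/G\to\widetilde X/G=X$, where $E$ has the discrete topology, $G$ acts by $g(\tilde x,e)=(g\tilde x,ge)$, and the fibre over $\phi(\tilde x)$ has the $k$-module structure for which the bijection $E\to$ fibre, $e\mapsto[(\tilde x,e)]$, is $k$-linear. -/

import Mathlib

open CategoryTheory CategoryTheory.Limits TopologicalSpace Opposite Topology

universe u

noncomputable section

namespace QcohRep

/-- A simply connected space: a connected space all of whose coverings are trivial. -/
def IsSimplyConn (X : Type u) [TopologicalSpace X] : Prop :=
  ConnectedSpace X ∧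
    ∀ (E : Type u) [TopologicalSpace E] (p : E → X), IsCoveringMap p →
      ∃ (F : Type u) (_ : TopologicalSpace F),
        DiscreteTopology F ∧ IsHomeomorphicTrivialFiberBundle F p

/-- A locally simply connected space: the simply connected open sets form a basis. -/
def IsLocallySimplyConn (X : Type u) [TopologicalSpace X] : Prop :=
  ∀ x : X, ∀ U ∈ 𝓝 x, ∃ V ⊆ U, IsOpen V ∧ x ∈ V ∧ IsSimplyConn V

/-- A universal covering: a (surjective) covering map from a simply connected space. -/
structure IsUniversalCovering {Y X : TopCat.{u}} (φ : Y ⟶ X) : Prop where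
  isCoveringMap : IsCoveringMap φ
  surjective : Function.Surjective φ
  isSimplyConn : IsSimplyConn Y

/-- The group `Aut_X Y` of automorphisms of `Y` over `X`. -/
abbrev Deck {Y X : TopCat.{u}} (φ : Y ⟶ X) : Type u := Aut (Over.mk φ)

/-! ### Quasi-coherent sheaves -/

/-- The category of sheaves of `k`-modules on `X`. -/
abbrev Shv (k : Type u) [Ring k] (X : TopCat.{u}) := TopCat.Sheaf (ModuleCat.{u} k) X

/-- The restriction of a sheaf to an open subset. -/
abbrev restrict (k : Type u) [Ring k] {X : TopCat.{u}} (U : Opens X) :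
    Shv k X ⥤ Shv k (TopCat.of U) :=
  (Opens.isOpenEmbedding' U).sheafPullback (f := U.inclusion') (ModuleCat.{u} k)

/-- The constant sheaf of `k`-modules on `X` with value `k`. -/
abbrev unitSheaf (k : Type u) [Ring k] (X : TopCat.{u}) : Shv k X :=
  (constantSheaf (Opens.grothendieckTopology X) (ModuleCat.{u} k)).obj (ModuleCat.of k k)

/-- The free sheaf: the direct sum of copies of the constant sheaf `k` indexed by `I`. -/
abbrev freeSheaf (k : Type u) [Ring k] (X : TopCat.{u}) (I : Type u) : Shv k X :=
  ∐ fun _ : I => unitSheaf k X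

/-- A sheaf of `k`-modules is quasi-coherent if locally there is an exact sequence
`k^(I) ⟶ k^(J) ⟶ F ⟶ 0`. -/
def isQuasicoherent (k : Type u) [Ring k] (X : TopCat.{u}) : ObjectProperty (Shv k X) :=
  fun F => ∀ x : X, ∃ U : Opens X, x ∈ U ∧ ∃ (I J : Type u)
    (f : freeSheaf k (TopCat.of U) I ⟶ freeSheaf k (TopCat.of U) J)
    (g : freeSheaf k (TopCat.of U) J ⟶ (restrict k U).obj F) (w : f ≫ g = 0),
    (ShortComplex.mk f g w).Exact ∧ Epi g

/-- The full subcategory of quasi-coherent sheaves. -/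
abbrev Qcoh (k : Type u) [Ring k] (X : TopCat.{u}) := (isQuasicoherent k X).FullSubcategory

/-! ### The functor `L ↦ Γ(Y, φ⁻¹ L)` -/

section Pull

variable (k : Type u) [Ring k] {Y X : TopCat.{u}} (φ : Y ⟶ X)

/-- If `h : Y ⟶ Y` lies over `X`, then `φ_* K = φ_* h_* K` for any sheaf `K` on `Y`. -/
def shift (h : Y ⟶ Y) (w : h ≫ φ = φ) :
    TopCat.Sheaf.pushforward (ModuleCat.{u} k) φ ⟶
      TopCat.Sheaf.pushforward (ModuleCat.{u} k) h ⋙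
        TopCat.Sheaf.pushforward (ModuleCat.{u} k) φ where
  app K := ⟨{ app := fun U => K.1.map (eqToHom (by
                show (Opens.map h).obj ((Opens.map φ).obj U.unop) = (Opens.map φ).obj U.unop
                rw [← Opens.map_comp_obj, w])).op
              naturality := by
                intro U V i
                dsimp
                erw [← K.1.map_comp, ← K.1.map_comp]
                rfl }⟩
  naturality := by
    intro K K' f
    exact Sheaf.hom_ext (NatTrans.ext (funext fun U => (f.hom.naturality _).symm))

/-- Pullback of sections of `φ⁻¹ L` along a map `h : Y ⟶ Y` over `X`, as a morphism
`φ⁻¹ L ⟶ h_* φ⁻¹ L`: it corresponds by adjunction to `L ⟶ φ_* φ⁻¹ L = φ_* h_* φ⁻¹ L`. -/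
def pullSections (h : Y ⟶ Y) (w : h ≫ φ = φ) (L : Shv k X) :
    (TopCat.Sheaf.pullback (ModuleCat.{u} k) φ).obj L ⟶
      (TopCat.Sheaf.pushforward (ModuleCat.{u} k) h).obj
        ((TopCat.Sheaf.pullback (ModuleCat.{u} k) φ).obj L) :=
  ((TopCat.Sheaf.pullbackPushforwardAdjunction (ModuleCat.{u} k) φ).homEquiv _ _).symm
    ((TopCat.Sheaf.pullbackPushforwardAdjunction (ModuleCat.{u} k) φ).unit.app L ≫
      (shift k φ h w).app _)

lemma homEquiv_pullSections (h : Y ⟶ Y) (w : h ≫ φ = φ) (L : Shv k X) :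
    ((TopCat.Sheaf.pullbackPushforwardAdjunction (ModuleCat.{u} k) φ).homEquiv _ _)
      (pullSections k φ h w L) =
    (TopCat.Sheaf.pullbackPushforwardAdjunction (ModuleCat.{u} k) φ).unit.app L ≫
      (shift k φ h w).app _ := by
  simp [pullSections]

lemma pullSections_naturality (h : Y ⟶ Y) (w : h ≫ φ = φ) {L L' : Shv k X} (f : L ⟶ L') :
    (TopCat.Sheaf.pullback (ModuleCat.{u} k) φ).map f ≫ pullSections k φ h w L' =
      pullSections k φ h w L ≫ (TopCat.Sheaf.pushforward (ModuleCat.{u} k) h).map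
        ((TopCat.Sheaf.pullback (ModuleCat.{u} k) φ).map f) := by
  apply ((TopCat.Sheaf.pullbackPushforwardAdjunction (ModuleCat.{u} k) φ).homEquiv _ _).injective
  rw [Adjunction.homEquiv_naturality_left, Adjunction.homEquiv_naturality_right,
    homEquiv_pullSections, homEquiv_pullSections, Category.assoc]
  erw [← (shift k φ h w).naturality]
  rw [← Category.assoc, ← Category.assoc]
  congr 1
  exact (TopCat.Sheaf.pullbackPushforwardAdjunction (ModuleCat.{u} k) φ).unit.naturality f

lemma pullSections_id (w : 𝟙 Y ≫ φ = φ) (L : Shv k X) :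
    (pullSections k φ (𝟙 Y) w L) = 𝟙 ((TopCat.Sheaf.pullback (ModuleCat.{u} k) φ).obj L) := by
  apply ((TopCat.Sheaf.pullbackPushforwardAdjunction (ModuleCat.{u} k) φ).homEquiv _ _).injective
  refine (homEquiv_pullSections k φ _ w L).trans ?_
  refine Eq.trans ?_ (Adjunction.homEquiv_id
    (TopCat.Sheaf.pullbackPushforwardAdjunction (ModuleCat.{u} k) φ) L).symm
  refine Eq.trans (congrArg (fun f =>
    (TopCat.Sheaf.pullbackPushforwardAdjunction (ModuleCat.{u} k) φ).unit.app L ≫ f)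
      (?_ : (shift k φ (𝟙 Y) w).app ((TopCat.Sheaf.pullback (ModuleCat.{u} k) φ).obj L) =
        𝟙 ((TopCat.Sheaf.pushforward (ModuleCat.{u} k) φ).obj
          ((TopCat.Sheaf.pullback (ModuleCat.{u} k) φ).obj L)))) (Category.comp_id _)
  refine Sheaf.hom_ext (NatTrans.ext (funext fun U => ?_))
  exact CategoryTheory.Functor.map_id _ _

lemma pullSections_comp (g h : Y ⟶ Y) (wg : g ≫ φ = φ) (wh : h ≫ φ = φ)
    (w : (g ≫ h) ≫ φ = φ) (L : Shv k X) :
    (pullSections k φ (g ≫ h) w L) = pullSections k φ h wh L ≫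
      (TopCat.Sheaf.pushforward (ModuleCat.{u} k) h).map (pullSections k φ g wg L) := by
  apply ((TopCat.Sheaf.pullbackPushforwardAdjunction (ModuleCat.{u} k) φ).homEquiv _ _).injective
  have e1 := (TopCat.Sheaf.pullbackPushforwardAdjunction (ModuleCat.{u} k)
    φ).homEquiv_naturality_right (pullSections k φ h wh L)
      ((TopCat.Sheaf.pushforward (ModuleCat.{u} k) h).map (pullSections k φ g wg L))
  have e2 := (TopCat.Sheaf.pullbackPushforwardAdjunction (ModuleCat.{u} k)
    φ).homEquiv_unit (f := pullSections k φ g wg L)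
  have e3 := (shift k φ h wh).naturality (pullSections k φ g wg L)
  dsimp only [Functor.comp_map] at e3
  rw [homEquiv_pullSections, Category.assoc] at e1
  erw [← e3] at e1
  rw [← Category.assoc, ← e2, homEquiv_pullSections, Category.assoc] at e1
  refine (homEquiv_pullSections k φ _ w L).trans (Eq.trans ?_ e1.symm)
  refine congrArg (fun f =>
    (TopCat.Sheaf.pullbackPushforwardAdjunction (ModuleCat.{u} k) φ).unit.app L ≫ f)
    (?_ : (shift k φ (g ≫ h) w).app ((TopCat.Sheaf.pullback (ModuleCat.{u} k) φ).obj L) =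
      (shift k φ g wg).app ((TopCat.Sheaf.pullback (ModuleCat.{u} k) φ).obj L) ≫
        (shift k φ h wh).app ((TopCat.Sheaf.pushforward (ModuleCat.{u} k) g).obj
          ((TopCat.Sheaf.pullback (ModuleCat.{u} k) φ).obj L)))
  refine Sheaf.hom_ext (NatTrans.ext (funext fun U => ?_))
  exact (congrArg _ (Subsingleton.elim _ _)).trans (CategoryTheory.Functor.map_comp _ _ _)

lemma congr_pullSections {g h : Y ⟶ Y} (e : g = h) (wg : g ≫ φ = φ) (wh : h ≫ φ = φ)
    (L : Shv k X) :
    (pullSections k φ g wg L).hom.app (op ⊤) = (pullSections k φ h wh L).hom.app (op ⊤) := by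
  subst e; rfl

/-- The action of `Aut_X Y` on `Γ(Y, φ⁻¹ L)`: an automorphism `g` acts by pulling back sections
along `g⁻¹`. -/
def deckRep (L : Shv k X) :
    Representation k (Deck φ) (((TopCat.Sheaf.pullback (ModuleCat.{u} k) φ).obj L).obj.obj (op ⊤)) where
  toFun g := ((pullSections k φ g⁻¹.hom.left (Over.w g⁻¹.hom) L).hom.app (op ⊤)).hom
  map_one' := by
    have := congrArg (fun f => (f.hom.app (op ⊤)).hom) (pullSections_id k φ (Category.id_comp φ) L)
    refine Eq.trans ?_ this
    exact congrArg ModuleCat.Hom.hom (congr_pullSections k φ (by simp; rfl) _ _ L)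
  map_mul' a b := by
    have := congrArg (fun f => (f.hom.app (op ⊤)).hom) (pullSections_comp k φ
      a⁻¹.hom.left b⁻¹.hom.left (Over.w _) (Over.w _)
      (by rw [Category.assoc]; exact (congrArg _ (Over.w _)).trans (Over.w _)) L)
    refine Eq.trans ?_ this
    exact congrArg ModuleCat.Hom.hom (congr_pullSections k φ (by rw [mul_inv_rev]; rfl) _ _ L)

/-- The functor `L ↦ Γ(Y, φ⁻¹ L)` from sheaves on `X` to representations of `Aut_X Y`. -/
def globalSections : Shv k X ⥤ Rep.{u} k (Deck φ) where
  obj L := Rep.of (deckRep k φ L)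
  map {L L'} f := Rep.ofHom
    ⟨(((TopCat.Sheaf.pullback (ModuleCat.{u} k) φ).map f).hom.app (op ⊤)).hom, fun g => by
      have := congrArg (fun f => (f.hom.app (op ⊤)).hom)
        (pullSections_naturality k φ g⁻¹.hom.left (Over.w g⁻¹.hom) f)
      exact this.symm⟩
  map_id L := by
    ext x
    simp
    rfl
  map_comp f g := by
    ext x
    simp
    rfl

end Pull

/-! ### The sheaf of sections of `(Y × E)/G` -/

section Galois

variable {Y X : TopCat.{u}} {φ : Y ⟶ X}

lemma deck_over (g : Deck φ) (y : Y) : φ (g.hom.left y) = φ y :=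
  congrArg (fun f : Y ⟶ X => f y) (Over.w g.hom)

instance : MulAction (Deck φ) Y where
  smul g y := g.hom.left y
  one_smul _ := rfl
  mul_smul _ _ _ := rfl

lemma map_smul_eq (g : Deck φ) (y : Y) : φ (g • y) = φ y := deck_over g y

instance : ContinuousConstSMul (Deck φ) Y where
  continuous_const_smul g := g.hom.left.hom.continuous

lemma IsUniversalCovering.smul_free (hφ : IsUniversalCovering φ) (g : Deck φ) (y : Y)
    (h : g • y = y) : g = 1 := by
  have := hφ.isSimplyConn.1
  have := hφ.isCoveringMap.eq_of_comp_eq (g₁ := fun y => g • y) (g₂ := fun y => y)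
    (continuous_const_smul g) continuous_id (funext fun z => map_smul_eq g z) y h
  apply Iso.ext
  apply Over.OverMorphism.ext
  ext z
  exact congrFun this z

/-- The first projection `Y ×_X Y ⟶ Y` is a covering map. -/
lemma IsUniversalCovering.isCoveringMap_fst (hφ : IsUniversalCovering φ) :
    IsCoveringMap (fun p : {p : Y × Y // φ p.1 = φ p.2} => p.1.1) := by
  intro y
  obtain ⟨_, U, hU, hUo, hUo', H, hH⟩ := hφ.isCoveringMap (φ y)
  refine IsEvenlyCovered.to_isEvenlyCovered_preimage (I := φ ⁻¹' {φ y})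
    ⟨inferInstance, φ ⁻¹' U, hU, hUo', hUo'.preimage (by fun_prop), ?_, ?_⟩
  · refine
    { toFun := fun p => (⟨p.1.1.1, p.2⟩, (H ⟨p.1.1.2, by
        have := p.2; rw [Set.mem_preimage, Set.mem_preimage, p.1.2] at this; exact this⟩).2)
      invFun := fun q => ⟨⟨(q.1.1, (H.symm (⟨φ q.1.1, q.1.2⟩, q.2)).1), by
        have := hH (H.symm (⟨φ q.1.1, q.1.2⟩, q.2))
        simpa using this⟩, q.1.2⟩
      left_inv := ?_
      right_inv := ?_
      continuous_toFun := ?_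
      continuous_invFun := ?_ }
    · rintro ⟨⟨⟨a, b⟩, hab⟩, ha⟩
      have hb : φ b ∈ U := by
        have : φ a ∈ U := ha
        simp only at hab; rwa [← hab]
      have : ((⟨φ a, ha⟩ : U), (H ⟨b, hb⟩).2) = H ⟨b, hb⟩ := by
        refine Prod.ext (Subtype.ext ?_) rfl
        exact hab.trans (hH ⟨b, hb⟩).symm
      apply Subtype.ext; apply Subtype.ext
      refine Prod.ext rfl ?_
      show (H.symm (⟨φ a, ha⟩, (H ⟨b, hb⟩).2)).1 = b
      rw [this]; simp
    · rintro ⟨⟨a, ha⟩, i⟩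
      refine Prod.ext rfl ?_
      simp
    · fun_prop
    · have := hφ.isCoveringMap.continuous
      fun_prop
  · intro p; rfl

/-- Through any point of the fibre there is a map over `X`. -/
lemma IsUniversalCovering.exists_map (hφ : IsUniversalCovering φ) {y y' : Y} (h : φ y = φ y') :
    ∃ f : Y ⟶ Y, f ≫ φ = φ ∧ f y = y' := by
  obtain ⟨F, _, _, e, he⟩ := hφ.isSimplyConn.2 _ _ hφ.isCoveringMap_fst
  let σ : Y → {p : Y × Y // φ p.1 = φ p.2} := fun a => e.symm (a, (e ⟨(y, y'), h⟩).2)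
  have hσ : Continuous σ := by fun_prop
  have h1 (a : Y) : (σ a).1.1 = a := by
    refine (he (σ a)).symm.trans ?_
    simp [σ]
  have h2 : σ y = ⟨(y, y'), h⟩ := by
    simp only [σ]
    rw [Homeomorph.symm_apply_eq]
    exact Prod.ext (he ⟨(y, y'), h⟩).symm rfl
  refine ⟨TopCat.ofHom ⟨fun a => (σ a).1.2, by fun_prop⟩, ?_, ?_⟩
  · ext a
    show φ (σ a).1.2 = φ a
    rw [← (σ a).2, h1]
  · show (σ y).1.2 = y'
    rw [h2]

lemma IsUniversalCovering.eq_id (hφ : IsUniversalCovering φ) {f : Y ⟶ Y} (hf : f ≫ φ = φ) {y : Y}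
    (h : f y = y) : f = 𝟙 Y := by
  have := hφ.isSimplyConn.1
  have := hφ.isCoveringMap.eq_of_comp_eq (g₁ := f) (g₂ := fun y => y)
    f.hom.continuous continuous_id (funext fun z => congrArg (fun f : Y ⟶ X => f z) hf) y h
  ext z
  exact congrFun this z

/-- `Aut_X Y` acts transitively on the fibres. -/
lemma IsUniversalCovering.smul_transitive (hφ : IsUniversalCovering φ) {y y' : Y}
    (h : φ y = φ y') : ∃ g : Deck φ, g • y = y' := by
  obtain ⟨f, hf, hfy⟩ := hφ.exists_map h
  obtain ⟨f', hf', hfy'⟩ := hφ.exists_map h.symm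
  refine ⟨Over.isoMk ⟨f, f', ?_, ?_⟩ hf, hfy⟩
  · exact hφ.eq_id (by rw [Category.assoc, hf', hf]) (y := y) (by simp [hfy, hfy'])
  · exact hφ.eq_id (by rw [Category.assoc, hf, hf']) (y := y') (by simp [hfy, hfy'])

end Galois

section Sections

variable {k : Type u} [Ring k] {Y X : TopCat.{u}} {φ : Y ⟶ X}

/-- The product `Y × E`, where `E` carries the discrete topology. -/
def ProdDisc (φ : Y ⟶ X) (E : Rep.{u} k (Deck φ)) : Type u := Y × E

instance (E : Rep.{u} k (Deck φ)) : TopologicalSpace (ProdDisc φ E) :=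
  @instTopologicalSpaceProd Y E _ ⊥

/-- The diagonal action `g (y, e) = (g y, g e)`. -/
instance (E : Rep.{u} k (Deck φ)) : MulAction (Deck φ) (ProdDisc φ E) where
  smul g p := (g • p.1, E.ρ g p.2)
  one_smul p := Prod.ext rfl (by show E.ρ 1 p.2 = p.2; simp)
  mul_smul a b p := Prod.ext rfl (by show E.ρ (a * b) p.2 = E.ρ a (E.ρ b p.2); simp)

instance (E : Rep.{u} k (Deck φ)) : ContinuousConstSMul (Deck φ) (ProdDisc φ E) where
  continuous_const_smul g := by
    let : TopologicalSpace E := ⊥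
    have : DiscreteTopology E := ⟨rfl⟩
    exact (continuous_const_smul (T := Y) g).prodMap
      (continuous_of_discreteTopology (f := fun e : E => E.ρ g e))

/-- The quotient space `(Y × E)/G`. -/
def Total (φ : Y ⟶ X) (E : Rep.{u} k (Deck φ)) : Type u :=
  Quotient (MulAction.orbitRel (Deck φ) (ProdDisc φ E))

instance (E : Rep.{u} k (Deck φ)) : TopologicalSpace (Total φ E) :=
  inferInstanceAs (TopologicalSpace (Quotient (MulAction.orbitRel (Deck φ) (ProdDisc φ E))))

/-- The class of `(y, e)` in `(Y × E)/G`. -/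
def Total.mk {E : Rep.{u} k (Deck φ)} (y : Y) (e : E) : Total φ E :=
  Quotient.mk (MulAction.orbitRel (Deck φ) (ProdDisc φ E)) (y, e)

/-- The projection `(Y × E)/G ⟶ X`. -/
def Total.proj {E : Rep.{u} k (Deck φ)} : Total φ E → X :=
  Quotient.lift (fun p : ProdDisc φ E => φ p.1) (by
    rintro a b ⟨g, rfl⟩
    exact map_smul_eq g b.1)

lemma Total.mk_eq_iff {E : Rep.{u} k (Deck φ)} {y y' : Y} {e e' : E} :
    (Total.mk y e : Total φ E) = Total.mk y' e' ↔ ∃ g : Deck φ, g • y' = y ∧ E.ρ g e' = e := by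
  refine Quotient.eq.trans ?_
  constructor
  · rintro ⟨g, hg⟩
    exact ⟨g, congrArg Prod.fst hg, congrArg Prod.snd hg⟩
  · rintro ⟨g, h1, h2⟩
    exact ⟨g, Prod.ext h1 h2⟩

lemma Total.continuous_mk {E : Rep.{u} k (Deck φ)} (e : E) :
    Continuous fun y => (Total.mk y e : Total φ E) := by
  let : TopologicalSpace E := ⊥
  exact continuous_quot_mk.comp (Continuous.prodMk_left (X := Y) e)

lemma Total.isOpen_image {E : Rep.{u} k (Deck φ)} (e : E) {V : Set Y} (hV : IsOpen V) :
    IsOpen ((fun y => (Total.mk y e : Total φ E)) '' V) := by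
  let : TopologicalSpace E := ⊥
  have : DiscreteTopology E := ⟨rfl⟩
  have h : IsOpenMap (Quotient.mk (MulAction.orbitRel (Deck φ) (ProdDisc φ E))) :=
    isOpenMap_quotient_mk'_mul
  have h2 : IsOpen (X := ProdDisc φ E) (V ×ˢ {e}) := hV.prod (isOpen_discrete {e})
  convert! h _ h2 using 1
  ext p
  constructor
  · rintro ⟨y, hy, rfl⟩
    exact ⟨(y, e), ⟨hy, rfl⟩, rfl⟩
  · rintro ⟨⟨y, e'⟩, ⟨hy, rfl⟩, rfl⟩
    exact ⟨y, hy, rfl⟩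

/-- The fibre of `(Y × E)/G ⟶ X` over `x`. -/
def Fib (_ : IsUniversalCovering φ) (E : Rep.{u} k (Deck φ)) (x : X) : Type u :=
  {p : Total φ E // p.proj = x}

variable (hφ : IsUniversalCovering φ) (E : Rep.{u} k (Deck φ))

/-- A point `y` over `x` identifies `E` with the fibre over `x`, by `e ↦ [y, e]`. -/
def fibEquiv (y : Y) {x : X} (hy : φ y = x) : E ≃ Fib hφ E x :=
  Equiv.ofBijective (fun e => ⟨Total.mk y e, hy⟩) (by
    constructor
    · intro a b h
      obtain ⟨g, h1, h2⟩ := Total.mk_eq_iff.1 (congrArg Subtype.val h)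
      obtain rfl := hφ.smul_free g y h1
      simpa using h2.symm
    · rintro ⟨p, hp⟩
      induction p using Quotient.ind with
      | _ q =>
      obtain ⟨y', e⟩ := q
      obtain ⟨g, rfl⟩ := hφ.smul_transitive (y := y) (y' := y') (hy.trans hp.symm)
      refine ⟨E.ρ g⁻¹ e, Subtype.ext ?_⟩
      exact Total.mk_eq_iff.2 ⟨g⁻¹, by simp, rfl⟩)

/-- The `k`-module structure on the fibres, for which all the identifications `fibEquiv` with `E`
are linear, see `fibLinearEquiv`. -/
instance (x : X) : AddCommGroup (Fib hφ E x) :=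
  (fibEquiv hφ E _ (hφ.surjective x).choose_spec).symm.addCommGroup

instance (x : X) : Module k (Fib hφ E x) :=
  (fibEquiv hφ E _ (hφ.surjective x).choose_spec).symm.module k

/-- The identification `e ↦ [y, e]` of `E` with the fibre over `x = φ y` is linear, for all `y`. -/
def fibLinearEquiv (y : Y) {x : X} (hy : φ y = x) : E ≃ₗ[k] Fib hφ E x where
  __ := fibEquiv hφ E y hy
  map_add' a b := by
    obtain ⟨g, hg⟩ := hφ.smul_transitive (y := y) (hy.trans (hφ.surjective x).choose_spec.symm)
    have key (e : E) : fibEquiv hφ E y hy e =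
        fibEquiv hφ E _ (hφ.surjective x).choose_spec (E.ρ g e) :=
      Subtype.ext (Total.mk_eq_iff.2 ⟨g⁻¹, by simp [← hg], by simp⟩)
    have hadd (a b : E) : fibEquiv hφ E _ (hφ.surjective x).choose_spec (a + b) =
        fibEquiv hφ E _ (hφ.surjective x).choose_spec a +
          fibEquiv hφ E _ (hφ.surjective x).choose_spec b := by
      simp [Equiv.add_def]
    show fibEquiv hφ E y hy (a + b) = fibEquiv hφ E y hy a + fibEquiv hφ E y hy b
    rw [key, key, key, map_add, hadd]
  map_smul' c a := by
    obtain ⟨g, hg⟩ := hφ.smul_transitive (y := y) (hy.trans (hφ.surjective x).choose_spec.symm)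
    have key (e : E) : fibEquiv hφ E y hy e =
        fibEquiv hφ E _ (hφ.surjective x).choose_spec (E.ρ g e) :=
      Subtype.ext (Total.mk_eq_iff.2 ⟨g⁻¹, by simp [← hg], by simp⟩)
    have hsmul (c : k) (a : E) : fibEquiv hφ E _ (hφ.surjective x).choose_spec (c • a) =
        c • fibEquiv hφ E _ (hφ.surjective x).choose_spec a := by
      simp [Equiv.smul_def]
    show fibEquiv hφ E y hy (c • a) = c • fibEquiv hφ E y hy a
    rw [key, key, map_smul, hsmul]

/-- A section of `(Y × E)/G` is continuous iff it is locally of the form `φ y ↦ [y, e]`. -/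
lemma continuous_section_iff {U : Opens X} (s : ∀ x : U, Fib hφ E x) :
    Continuous (fun x : U => (s x).1) ↔
      ∀ (y : Y) (hy : φ y ∈ U), ∃ e : E, ∀ᶠ z in 𝓝 y, ∀ hz : φ z ∈ U,
        s ⟨φ z, hz⟩ = fibLinearEquiv hφ E z rfl e := by
  have hloc := hφ.isCoveringMap.isLocalHomeomorph
  constructor
  · intro hs y hy
    obtain ⟨e, he⟩ := (fibLinearEquiv hφ E y rfl).surjective (s ⟨φ y, hy⟩)
    refine ⟨e, ?_⟩
    obtain ⟨V, hVo, hyV, hV⟩ : ∃ V : Set Y, IsOpen V ∧ y ∈ V ∧ Set.InjOn φ V := by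
      obtain ⟨t, ht, hte⟩ := hloc y
      exact ⟨t.source, t.open_source, ht, by rw [hte]; exact t.injOn⟩
    have hopen := (Total.isOpen_image (E := E) e hVo).preimage hs
    obtain ⟨W, hW, hWeq⟩ := isOpen_induced_iff.1 hopen
    have hyW : φ y ∈ W := by
      have : (⟨φ y, hy⟩ : U) ∈ Subtype.val ⁻¹' W := by
        rw [hWeq]
        exact ⟨y, hyV, congrArg Subtype.val he⟩
      exact this
    filter_upwards [hVo.mem_nhds hyV,
      (hW.preimage hφ.isCoveringMap.continuous).mem_nhds hyW] with z hzV hzW hz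
    have : (⟨φ z, hz⟩ : U) ∈ Subtype.val ⁻¹' W := hzW
    rw [hWeq] at this
    obtain ⟨z', hz'V, hz'⟩ := this
    have h1 : φ z' = φ z := by
      have := congrArg Total.proj hz'
      exact this.trans (s ⟨φ z, hz⟩).2
    obtain rfl := hV hz'V hzV h1
    exact Subtype.ext hz'.symm
  · intro h
    rw [continuous_iff_continuousAt]
    rintro ⟨x, hx⟩
    obtain ⟨y, rfl⟩ := hφ.surjective x
    obtain ⟨e, he⟩ := h y hx
    have hU : ∀ᶠ z in 𝓝 y, φ z ∈ U :=
      hφ.isCoveringMap.continuous.continuousAt.eventually (U.2.mem_nhds hx)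
    rw [ContinuousAt, nhds_subtype_eq_comap]
    rw [Filter.tendsto_def]
    intro N hN
    have hs : (s ⟨φ y, hx⟩).1 = Total.mk y e :=
      congrArg Subtype.val (he.self_of_nhds hx)
    rw [hs] at hN
    have h2 := (Total.continuous_mk (E := E) e).continuousAt.eventually hN
    refine ⟨{x | ∀ h : x ∈ U, (s ⟨x, h⟩).1 ∈ N}, ?_, fun a ha => ha a.2⟩
    rw [← hloc.map_nhds_eq y, Filter.mem_map]
    filter_upwards [h2, he] with z h3 h4 h5
    rw [h4 h5]
    exact h3

/-- The `k`-module of continuous sections of `(Y × E)/G` over `U`. -/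
def contSections (U : Opens X) : Submodule k (∀ x : U, Fib hφ E x) where
  carrier := {s | Continuous fun x : U => (s x).1}
  zero_mem' := (continuous_section_iff hφ E _).2 fun _ _ =>
    ⟨0, .of_forall fun z hz => (map_zero (fibLinearEquiv hφ E z rfl)).symm⟩
  add_mem' {s t} hs ht := (continuous_section_iff hφ E _).2 fun y hy => by
    obtain ⟨a, ha⟩ := (continuous_section_iff hφ E _).1 hs y hy
    obtain ⟨b, hb⟩ := (continuous_section_iff hφ E _).1 ht y hy
    refine ⟨a + b, ?_⟩
    filter_upwards [ha, hb] with z h1 h2 hz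
    rw [map_add, ← h1 hz, ← h2 hz]
    rfl
  smul_mem' c s hs := (continuous_section_iff hφ E _).2 fun y hy => by
    obtain ⟨a, ha⟩ := (continuous_section_iff hφ E _).1 hs y hy
    refine ⟨c • a, ?_⟩
    filter_upwards [ha] with z h1 hz
    rw [map_smul, ← h1 hz]
    rfl

/-- The presheaf of continuous sections of `(Y × E)/G`. -/
def sectionsPresheaf : TopCat.Presheaf (ModuleCat.{u} k) X where
  obj U := ModuleCat.of k (contSections hφ E U.unop)
  map i := ModuleCat.ofHom
    { toFun := fun s => ⟨fun x => s.1 ⟨x.1, i.unop.le x.2⟩,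
        s.2.comp (continuous_subtype_val.subtype_mk fun x => i.unop.le x.2)⟩
      map_add' := fun _ _ => rfl
      map_smul' := fun _ _ => rfl }

/-- Continuity of sections is a local condition. -/
def contPredicate : TopCat.LocalPredicate (X := X) (Fib hφ E) where
  pred {U} s := Continuous fun x : U => (s x).1
  res i _ hs := hs.comp (continuous_subtype_val.subtype_mk fun x => i.le x.2)
  locality s h := (TopCat.continuousLocal X (Total φ E)).locality (fun x => (s x).1) h

lemma sectionsPresheaf_isSheaf : (sectionsPresheaf hφ E).IsSheaf := by
  rw [TopCat.Presheaf.isSheaf_iff_isSheaf_comp (forget (ModuleCat.{u} k))]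
  exact TopCat.subpresheafToTypes.isSheaf (contPredicate hφ E)

/-- The sheaf of sections of `(Y × E)/G ⟶ X`. -/
def sectionsSheaf : Shv k X := ⟨sectionsPresheaf hφ E, sectionsPresheaf_isSheaf hφ E⟩

variable {E} {E' : Rep.{u} k (Deck φ)} (f : E ⟶ E')

/-- The map `(Y × E)/G ⟶ (Y × E')/G`, `[y, e] ↦ [y, f e]`. -/
def Total.map : Total φ E → Total φ E' :=
  Quotient.map (fun p : ProdDisc φ E => ((p.1, f.hom p.2) : ProdDisc φ E')) (by
    rintro a b ⟨g, rfl⟩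
    exact ⟨g, Prod.ext rfl (Representation.IntertwiningMap.isIntertwining _ _ f.hom g b.2).symm⟩)

lemma Total.continuous_map : Continuous (Total.map f) := by
  refine Continuous.quotient_map' (?_ : Continuous _) _
  let : TopologicalSpace E := ⊥
  let : TopologicalSpace E' := ⊥
  have : DiscreteTopology E := ⟨rfl⟩
  exact (continuous_id (X := Y)).prodMap (continuous_of_discreteTopology (f := fun e : E => f.hom e))

lemma Total.proj_map (p : Total φ E) : (Total.map f p).proj = p.proj := by
  induction p using Quotient.ind with
  | _ q => rfl

/-- The induced linear map on fibres. -/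
def Fib.map (x : X) : Fib hφ E x →ₗ[k] Fib hφ E' x :=
  { toFun := fun p => ⟨Total.map f p.1, (Total.proj_map f p.1).trans p.2⟩
    map_add' := fun p q => by
      obtain ⟨y, hy⟩ := hφ.surjective x
      obtain ⟨a, rfl⟩ := (fibLinearEquiv hφ E y hy).surjective p
      obtain ⟨b, rfl⟩ := (fibLinearEquiv hφ E y hy).surjective q
      rw [← map_add]
      refine Eq.trans ?_ (map_add (fibLinearEquiv hφ E' y hy) (f.hom a) (f.hom b))
      rw [← map_add]
      rfl
    map_smul' := fun c p => by
      obtain ⟨y, hy⟩ := hφ.surjective x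
      obtain ⟨a, rfl⟩ := (fibLinearEquiv hφ E y hy).surjective p
      rw [← map_smul]
      refine Eq.trans ?_ (map_smul (fibLinearEquiv hφ E' y hy) c (f.hom a))
      rw [← map_smul]
      rfl }

variable (k)

/-- The functor `E ↦` sheaf of sections of `(Y × E)/G ⟶ X`. -/
def associatedSheaf : Rep.{u} k (Deck φ) ⥤ Shv k X where
  obj E := sectionsSheaf hφ E
  map {E E'} f := ⟨{
    app := fun U => ModuleCat.ofHom
      { toFun := fun s => ⟨fun x => Fib.map hφ f x.1 (s.1 x),
          (Total.continuous_map f).comp s.2⟩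
        map_add' := fun s t => Subtype.ext (funext fun x => map_add (Fib.map hφ f x.1) _ _)
        map_smul' := fun c s => Subtype.ext (funext fun x => map_smul (Fib.map hφ f x.1) _ _) }
    naturality := fun U V i => rfl }⟩
  map_id E := by
    refine Sheaf.hom_ext (NatTrans.ext (funext fun U => ?_))
    ext s
    refine Subtype.ext (funext fun x => Subtype.ext ?_)
    show Total.map (𝟙 E) (s.1 x).1 = (s.1 x).1
    induction (s.1 x).1 using Quotient.ind with
    | _ q => rfl
  map_comp f g := by
    refine Sheaf.hom_ext (NatTrans.ext (funext fun U => ?_))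
    ext s
    refine Subtype.ext (funext fun x => Subtype.ext ?_)
    show Total.map (f ≫ g) (s.1 x).1 = Total.map g (Total.map f (s.1 x).1)
    induction (s.1 x).1 using Quotient.ind with
    | _ q => rfl

end Sections

end QcohRep

end

noncomputable section

namespace QcohRep

/-! ### Sections and germs of sheaves of modules -/

section Sec

variable {k : Type u} [Ring k] {X : TopCat.{u}}

/-! On a locally connected space quasi-coherent means locally constant. If `F` is locally the
cokernel of a map of free sheaves, these are constant, and over a connected open set the map is
given by a single linear map `α`, so `F` is constant there with value `coker α`
(`exists_isTriv_of_exact`). Conversely, the constant sheaf functor is exact and preserves direct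
sums, so it turns a free presentation of a module into one of the constant sheaf
(`exists_presentation_cst`).

For `L` locally constant on `X`, the sheaf `φ⁻¹ L` is locally constant on `Y`. Its étale space is a
covering of a simply connected space, hence trivial, so every germ extends uniquely to a global
section (`IsLC.bijective_gm_top`). Thus `Γ(Y, φ⁻¹ L) ≅ (φ⁻¹ L)_y ≅ L_{φ y}` for every `y`, and
moving `y` in its fibre is the action of `G` (`ggm_ρ`). A section `s` of `L` yields the section `φ y
↦ [y, global extension of the germ of s at y]` of the associated bundle. It does not depend on the
choice of `y`, because `G` is transitive on fibres, and the resulting morphism is bijective on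
stalks (`isIso_toAssociated`).

In the other direction, sections of `(Y × E)/G` become locally constant `E`-valued functions after
pullback to `Y`. Since `Y` is connected, the global ones are the elements of `E`
(`exists_unitEquiv`), compatibly with `G` (`unitEquiv_ρ`).

Constancy is encoded by `IsTriv` as bijectivity of `M → F_x`, so nearly every verification is a
comparison of germs. -/

/-- The module of sections of a sheaf over an open set. -/
def Sec (F : Shv k X) (U : Opens X) : ModuleCat.{u} k := F.obj.obj (op U)

/-- The stalk of a sheaf at a point. -/
def St (F : Shv k X) (x : X) : ModuleCat.{u} k :=
  TopCat.Presheaf.stalk (C := ModuleCat.{u} k) F.obj x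

/-- Restriction of sections. -/
def res (F : Shv k X) {U V : Opens X} (h : V ≤ U) : Sec F U →ₗ[k] Sec F V :=
  (F.obj.map (homOfLE h).op).hom

/-- The germ of a section at a point. -/
def gm (F : Shv k X) {U : Opens X} (x : X) (hx : x ∈ U) : Sec F U →ₗ[k] St F x :=
  (TopCat.Presheaf.germ (C := ModuleCat.{u} k) F.obj U x hx).hom

/-- The action of a morphism of sheaves on sections. -/
def ap {F G : Shv k X} (f : F ⟶ G) (U : Opens X) : Sec F U →ₗ[k] Sec G U :=
  (f.hom.app (op U)).hom

/-- The action of a morphism of sheaves on stalks. -/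
def stMap {F G : Shv k X} (f : F ⟶ G) (x : X) : St F x →ₗ[k] St G x :=
  ((TopCat.Presheaf.stalkFunctor (ModuleCat.{u} k) x).map f.hom).hom

variable (F G : Shv k X)

@[simp] lemma res_self {U : Opens X} (h : U ≤ U) (s : Sec F U) : res F h s = s := by
  have : F.obj.map (homOfLE h).op = 𝟙 _ := F.obj.map_id (op U)
  exact congrArg (fun f => f.hom s) this

@[simp] lemma res_res {U V W : Opens X} (h : V ≤ U) (h' : W ≤ V) (s : Sec F U) :
    res F h' (res F h s) = res F (h'.trans h) s := by
  have : F.obj.map ((homOfLE h).op ≫ (homOfLE h').op) = _ := F.obj.map_comp _ _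
  exact (congrArg (fun f => f.hom s) this).symm

@[simp] lemma gm_res {U V : Opens X} (h : V ≤ U) {x : X} (hx : x ∈ V) (s : Sec F U) :
    gm F x hx (res F h s) = gm F x (h hx) s :=
  TopCat.Presheaf.germ_res_apply (C := ModuleCat.{u} k) F.obj (homOfLE h) x hx s

variable {F G}

lemma exists_gm_eq {x : X} (t : St F x) :
    ∃ (U : Opens X) (hx : x ∈ U) (s : Sec F U), gm F x hx s = t :=
  TopCat.Presheaf.exists_germ_eq (C := ModuleCat.{u} k) F.obj t

lemma exists_res_eq {U V : Opens X} {x : X} {hU : x ∈ U} {hV : x ∈ V} {s : Sec F U} {t : Sec F V}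
    (h : gm F x hU s = gm F x hV t) :
    ∃ (W : Opens X) (_ : x ∈ W) (h1 : W ≤ U) (h2 : W ≤ V), res F h1 s = res F h2 t := by
  obtain ⟨W, hW, i, j, e⟩ :=
    TopCat.Presheaf.germ_eq (C := ModuleCat.{u} k) F.obj x hU hV s t h
  exact ⟨W, hW, i.le, j.le, e⟩

lemma sec_ext {U : Opens X} {s t : Sec F U} (h : ∀ x (hx : x ∈ U), gm F x hx s = gm F x hx t) :
    s = t :=
  TopCat.Presheaf.section_ext F U s t h

lemma exists_glue {ι : Type u} (V : ι → Opens X) (U : Opens X) (hV : ∀ i, V i ≤ U)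
    (hU : ∀ x ∈ U, ∃ i, x ∈ V i) (s : ∀ i, Sec F (V i))
    (hs : ∀ i j x (hi : x ∈ V i) (hj : x ∈ V j), gm F x hi (s i) = gm F x hj (s j)) :
    ∃ t : Sec F U, ∀ i, res F (hV i) t = s i := by
  obtain ⟨t, ht, -⟩ := TopCat.Sheaf.existsUnique_gluing' F V U (fun i => homOfLE (hV i))
    (fun x hx => by simpa using hU x hx) s (by
      intro i j
      refine sec_ext (F := F) (U := V i ⊓ V j) fun x hx => ?_
      refine (gm_res F inf_le_left hx (s i)).trans (.trans ?_
        (gm_res F inf_le_right hx (s j)).symm)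
      exact hs i j x _ _)
  exact ⟨t, ht⟩

@[simp] lemma ap_res (f : F ⟶ G) {U V : Opens X} (h : V ≤ U) (s : Sec F U) :
    ap f V (res F h s) = res G h (ap f U s) :=
  congrArg (fun f => f.hom s) (f.hom.naturality (homOfLE h).op)

@[simp] lemma stMap_gm (f : F ⟶ G) {U : Opens X} {x : X} (hx : x ∈ U) (s : Sec F U) :
    stMap f x (gm F x hx s) = gm G x hx (ap f U s) :=
  TopCat.Presheaf.stalkFunctor_map_germ_apply (C := ModuleCat.{u} k) U x hx f.hom s

@[simp] lemma ap_comp {H : Shv k X} (f : F ⟶ G) (g : G ⟶ H) (U : Opens X) (s : Sec F U) :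
    ap (f ≫ g) U s = ap g U (ap f U s) := rfl

@[simp] lemma ap_zero (U : Opens X) (s : Sec F U) : ap (0 : F ⟶ G) U s = 0 := rfl

lemma hom_ext_ap {f g : F ⟶ G} (h : ∀ U s, ap f U s = ap g U s) : f = g := by
  refine Sheaf.hom_ext (NatTrans.ext (funext fun U => ModuleCat.hom_ext (LinearMap.ext fun s => ?_)))
  exact h U.unop s

/-- A morphism of sheaves given by linear maps on sections. -/
def homMk (f : ∀ U, Sec F U →ₗ[k] Sec G U)
    (hf : ∀ U V (h : V ≤ U) s, f V (res F h s) = res G h (f U s)) : F ⟶ G :=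
  ⟨{ app := fun U => ModuleCat.ofHom (f U.unop)
     naturality := fun U V i => by
       refine ModuleCat.hom_ext (LinearMap.ext fun s => ?_)
       exact hf U.unop V.unop i.unop.le s }⟩

lemma isIso_iff_bijective_stMap (f : F ⟶ G) :
    IsIso f ↔ ∀ x, Function.Bijective (stMap f x) := by
  refine (TopCat.Presheaf.isIso_iff_stalkFunctor_map_iso f).trans (forall_congr' fun x => ?_)
  exact ConcreteCategory.isIso_iff_bijective
    ((TopCat.Presheaf.stalkFunctor (ModuleCat.{u} k) x).map f.hom)

end Sec

/-! ### Stalks of the inverse image sheaf. -/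

section PullbackStalk

variable {k : Type u} [Ring k] {Y X : TopCat.{u}} (φ : Y ⟶ X)

/-- The map `L_{φ y} ⟶ K_y` induced by a morphism of presheaves `L ⟶ φ_* K`. -/
def stalkMap {L : TopCat.Presheaf (ModuleCat.{u} k) X} {K : TopCat.Presheaf (ModuleCat.{u} k) Y}
    (η : L ⟶ (TopCat.Presheaf.pushforward (ModuleCat.{u} k) φ).obj K) (y : Y) :
    L.stalk (φ y) ⟶ K.stalk y :=
  (TopCat.Presheaf.stalkFunctor _ (φ y)).map η ≫ TopCat.Presheaf.stalkPushforward _ φ K y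

lemma germ_stalkMap {L : TopCat.Presheaf (ModuleCat.{u} k) X}
    {K : TopCat.Presheaf (ModuleCat.{u} k) Y}
    (η : L ⟶ (TopCat.Presheaf.pushforward (ModuleCat.{u} k) φ).obj K) (y : Y) (U : Opens X)
    (hy : φ y ∈ U) :
    L.germ U (φ y) hy ≫ stalkMap φ η y = η.app (op U) ≫ K.germ ((Opens.map φ).obj U) y hy := by
  refine (TopCat.Presheaf.stalkFunctor_map_germ_assoc U (φ y) hy η _).trans ?_
  exact congrArg (fun f => η.app (op U) ≫ f) (TopCat.Presheaf.stalkPushforward_germ _ φ K U y hy)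

lemma stalkMap_comp {L : TopCat.Presheaf (ModuleCat.{u} k) X}
    {K K' : TopCat.Presheaf (ModuleCat.{u} k) Y}
    (η : L ⟶ (TopCat.Presheaf.pushforward (ModuleCat.{u} k) φ).obj K) (f : K ⟶ K') (y : Y) :
    stalkMap φ (η ≫ (TopCat.Presheaf.pushforward (ModuleCat.{u} k) φ).map f) y =
      stalkMap φ η y ≫ (TopCat.Presheaf.stalkFunctor _ y).map f := by
  refine TopCat.Presheaf.stalk_hom_ext _ fun U hU => ?_
  refine (germ_stalkMap φ _ y U hU).trans (.trans ?_ (Category.assoc _ _ _))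
  refine Eq.trans ?_ (congrArg (fun g => g ≫ (TopCat.Presheaf.stalkFunctor _ y).map f)
    (germ_stalkMap φ η y U hU)).symm
  refine Eq.trans ?_ (Category.assoc _ _ _).symm
  exact congrArg (fun g => η.app (op U) ≫ g)
    (TopCat.Presheaf.stalkFunctor_map_germ _ y _ f).symm

/-- The stalks of the inverse image of a sheaf. -/
lemma isIso_stalkMap_unit (L : Shv k X) (y : Y) :
    IsIso (stalkMap φ
      ((TopCat.Sheaf.pullbackPushforwardAdjunction (ModuleCat.{u} k) φ).unit.app L).hom y) := by
  -- The abstract inverse image is compared with the explicit one, presheaf pullback followed by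
  -- sheafification, through uniqueness of left adjoints.
  let adj := Functor.sheafPullbackConstruction.sheafAdjunctionContinuous (Opens.map φ)
    (ModuleCat.{u} k) (Opens.grothendieckTopology X) (Opens.grothendieckTopology Y)
  let adj' := TopCat.Sheaf.pullbackPushforwardAdjunction (ModuleCat.{u} k) φ
  let e := (adj'.leftAdjointUniq adj).app L
  let P : TopCat.Presheaf (ModuleCat.{u} k) X := L.obj
  have h : (adj'.unit.app L).hom ≫
      (TopCat.Presheaf.pushforward (ModuleCat.{u} k) φ).map e.hom.hom = (adj.unit.app L).hom :=
    congrArg (fun f => f.hom) (Adjunction.unit_leftAdjointUniq_hom_app adj' adj L)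
  have h' : (adj.unit.app L).hom = (TopCat.Presheaf.pullbackPushforwardAdjunction _ φ).unit.app P ≫
      (TopCat.Presheaf.pushforward (ModuleCat.{u} k) φ).map (toSheafify
        (Opens.grothendieckTopology Y) ((TopCat.Presheaf.pullback _ φ).obj P)) := by
    simp [adj, Functor.sheafPullbackConstruction.sheafAdjunctionContinuous]
    rfl
  -- Three of the four maps in this square are isomorphisms: the comparison `e` on stalks, the stalk
  -- of a presheaf pullback, and sheafification on stalks. Hence so is the fourth.
  have h2 : stalkMap φ (adj'.unit.app L).hom y ≫ (TopCat.Presheaf.stalkFunctor _ y).map e.hom.hom =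
      TopCat.Presheaf.stalkPullbackHom _ φ P y ≫ (TopCat.Presheaf.stalkFunctor _ y).map
        (toSheafify (Opens.grothendieckTopology Y) ((TopCat.Presheaf.pullback _ φ).obj P)) := by
    refine (stalkMap_comp φ (adj'.unit.app L).hom e.hom.hom y).symm.trans ?_
    refine (congrArg (fun f => stalkMap φ f y) (h.trans h')).trans ?_
    exact stalkMap_comp φ _ _ y
  have h3 : IsIso (TopCat.Presheaf.stalkPullbackHom _ φ P y) :=
    (TopCat.Presheaf.stalkPullbackIso _ φ P y).isIso_hom
  have h4 := TopCat.Presheaf.stalkFunctor_map_unit_toSheafify_isIso y _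
    ((TopCat.Presheaf.pullback (ModuleCat.{u} k) φ).obj P)
  have h5 : IsIso ((TopCat.Presheaf.stalkFunctor _ y).map e.hom.hom) :=
    (TopCat.Presheaf.isIso_iff_stalkFunctor_map_iso e.hom).1 e.isIso_hom y
  have h6 := IsIso.comp_isIso' h3 h4
  rw [← h2] at h6
  exact @IsIso.of_isIso_comp_right _ _ _ _ _ _ _ h5 h6

variable {φ}

/-- The inverse image of a sheaf. -/
abbrev inv (φ : Y ⟶ X) (L : Shv k X) : Shv k Y :=
  (TopCat.Sheaf.pullback (ModuleCat.{u} k) φ).obj L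

/-- Pullback of sections `L(U) ⟶ (φ⁻¹ L)(φ⁻¹ U)`. -/
def pb (φ : Y ⟶ X) (L : Shv k X) (U : Opens X) :
    Sec L U →ₗ[k] Sec (inv φ L) ((Opens.map φ).obj U) :=
  (((TopCat.Sheaf.pullbackPushforwardAdjunction (ModuleCat.{u} k) φ).unit.app L).hom.app (op U)).hom

lemma pb_res (L : Shv k X) {U V : Opens X} (h : V ≤ U) (s : Sec L U) :
    pb φ L V (res L h s) = res (inv φ L) (fun _ hy => h hy) (pb φ L U s) :=
  congrArg (fun f => f.hom s)
    (((TopCat.Sheaf.pullbackPushforwardAdjunction (ModuleCat.{u} k) φ).unit.app L).hom.naturality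
      (homOfLE h).op)

lemma ap_pb {L L' : Shv k X} (f : L ⟶ L') {U : Opens X} (s : Sec L U) :
    ap ((TopCat.Sheaf.pullback (ModuleCat.{u} k) φ).map f) _ (pb φ L U s) =
      pb φ L' U (ap f U s) :=
  congrArg (fun g => (g.hom.app (op U)).hom s)
    ((TopCat.Sheaf.pullbackPushforwardAdjunction (ModuleCat.{u} k) φ).unit.naturality f).symm

lemma stMap_gm_pb {L L' : Shv k X} (f : L ⟶ L') {U : Opens X} {y : Y} (hy : φ y ∈ U)
    (s : Sec L U) :
    stMap ((TopCat.Sheaf.pullback (ModuleCat.{u} k) φ).map f) y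
        (gm (inv φ L) (U := (Opens.map φ).obj U) y hy (pb φ L U s)) =
      gm (inv φ L') (U := (Opens.map φ).obj U) y hy (pb φ L' U (ap f U s)) :=
  (stMap_gm _ (U := (Opens.map φ).obj U) hy _).trans (congrArg _ (ap_pb f s))

/-- The isomorphism `L_{φ y} ≃ (φ⁻¹ L)_y`. -/
def stPb (φ : Y ⟶ X) (L : Shv k X) (y : Y) : St L (φ y) ≃ₗ[k] St (inv φ L) y :=
  (@asIso _ _ _ _ _ (isIso_stalkMap_unit φ L y)).toLinearEquiv

lemma stPb_gm (L : Shv k X) {U : Opens X} {y : Y} (hy : φ y ∈ U) (s : Sec L U) :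
    stPb φ L y (gm L (φ y) hy s) = gm (inv φ L) (U := (Opens.map φ).obj U) y hy (pb φ L U s) :=
  congrArg (fun f => f.hom s) (germ_stalkMap φ
    ((TopCat.Sheaf.pullbackPushforwardAdjunction (ModuleCat.{u} k) φ).unit.app L).hom y U hy)

/-- Every germ of `φ⁻¹ L` is the germ of a pulled back section. -/
lemma exists_gm_pb (L : Shv k X) {y : Y} (t : St (inv φ L) y) :
    ∃ (U : Opens X) (hy : φ y ∈ U) (s : Sec L U),
      gm (inv φ L) (U := (Opens.map φ).obj U) y hy (pb φ L U s) = t := by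
  obtain ⟨t, rfl⟩ := (stPb φ L y).surjective t
  obtain ⟨U, hy, s, rfl⟩ := exists_gm_eq t
  exact ⟨U, hy, s, (stPb_gm L hy s).symm⟩

end PullbackStalk

/-! ### Locally constant sheaves -/

section LocallyConstant

variable {k : Type u} [Ring k] {Y X : TopCat.{u}}

/-- A linear map `f : M → F(U)` exhibits `F` as constant on `U` if it induces bijections of `M`
with the stalks of `F` at the points of `U`. -/
def IsTriv (F : Shv k X) (U : Opens X) {M : ModuleCat.{u} k} (f : M →ₗ[k] Sec F U) : Prop :=
  ∀ x (hx : x ∈ U), Function.Bijective fun m => gm F x hx (f m)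

/-- Locally constant sheaves. -/
def IsLC (F : Shv k X) : Prop :=
  ∀ x : X, ∃ U : Opens X, x ∈ U ∧ ∃ (M : ModuleCat.{u} k) (f : M →ₗ[k] Sec F U), IsTriv F U f

/-- Sections with equal germs at a point agree on a neighbourhood of it. This supplies openness in
the connectedness arguments. -/
lemma isOpen_gm_eq {F : Shv k X} {U V : Opens X} (s : Sec F U) (t : Sec F V) :
    IsOpen {x | ∃ (hU : x ∈ U) (hV : x ∈ V), gm F x hU s = gm F x hV t} := by
  rw [isOpen_iff_mem_nhds]
  rintro x ⟨hU, hV, h⟩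
  obtain ⟨W, hx, h1, h2, e⟩ := exists_res_eq h
  filter_upwards [W.2.mem_nhds hx] with z hz
  refine ⟨h1 hz, h2 hz, ?_⟩
  rw [← gm_res F h1 hz, e, gm_res]

/-- Sections of a constant sheaf over connected sets are constant. -/
lemma IsTriv.gm_eq {F : Shv k X} {U : Opens X} {M : ModuleCat.{u} k} {f : M →ₗ[k] Sec F U}
    (hf : IsTriv F U f) {V : Opens X} (hVU : V ≤ U) (hV : IsPreconnected (V : Set X))
    (s : Sec F V) {x y : X} (hx : x ∈ V) (hy : y ∈ V) {m : M}
    (h : gm F x (hVU hx) (f m) = gm F x hx s) : gm F y (hVU hy) (f m) = gm F y hy s := by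
  let A (n : M) : Set X := {z | ∃ (h1 : z ∈ U) (h2 : z ∈ V), gm F z h1 (f n) = gm F z h2 s}
  have hA (n : M) : IsOpen (A n) := isOpen_gm_eq _ _
  -- The open sets `A n` are pairwise disjoint by injectivity of `M → F_z` and cover `V` by
  -- surjectivity. As `V` is preconnected and meets `A m`, it lies inside it.
  have key : (V : Set X) ⊆ A m := by
    refine hV.subset_left_of_subset_union (hA m)
      (isOpen_iUnion fun n : {n // n ≠ m} => hA n.1) ?_ ?_ ⟨x, hx, hVU hx, hx, h⟩
    · rw [Set.disjoint_iUnion_right]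
      rintro ⟨n, hn⟩
      rw [Set.disjoint_left]
      rintro z ⟨h1, h2, e⟩ ⟨_, _, e'⟩
      exact hn ((hf z h1).1 (e'.trans e.symm))
    · intro z hz
      obtain ⟨n, hn⟩ := (hf z (hVU hz)).2 (gm F z hz s)
      by_cases e : n = m
      · subst e
        exact .inl ⟨hVU hz, hz, hn⟩
      · exact .inr (Set.mem_iUnion.2 ⟨⟨n, e⟩, hVU hz, hz, hn⟩)
  exact (key hy).2.2

/-- Every germ at `x` is that of some `f m`, and by `IsTriv.gm_eq` a section over `V` with that germ
has the germs of `f m` throughout. -/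
lemma IsTriv.bijective_gm {F : Shv k X} {U : Opens X} {M : ModuleCat.{u} k} {f : M →ₗ[k] Sec F U}
    (hf : IsTriv F U f) {V : Opens X} (hVU : V ≤ U) (hV : IsPreconnected (V : Set X))
    {x : X} (hx : x ∈ V) : Function.Bijective (gm F (U := V) x hx) := by
  constructor
  · intro s t h
    obtain ⟨m, hm⟩ := (hf x (hVU hx)).2 (gm F x hx s)
    exact sec_ext fun y hy =>
      (hf.gm_eq hVU hV s hx hy hm).symm.trans (hf.gm_eq hVU hV t hx hy (hm.trans h))
  · intro t
    obtain ⟨m, hm⟩ := (hf x (hVU hx)).2 t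
    exact ⟨res F hVU (f m), by rw [gm_res]; exact hm⟩

lemma IsLC.inv {L : Shv k X} (hL : IsLC L) (φ : Y ⟶ X) : IsLC (inv φ L) := by
  intro y
  obtain ⟨U, hU, M, f, hf⟩ := hL (φ y)
  refine ⟨(Opens.map φ).obj U, hU, M, pb φ L U ∘ₗ f, fun z hz => ?_⟩
  have := (stPb φ L z).bijective.comp (hf (φ z) hz)
  convert this using 1
  exact funext fun m => (stPb_gm L _ _).symm

/-- This form of local constancy, free of any chosen module, is what makes the étale space a
covering. -/
lemma IsLC.exists_bijective_gm [LocallyConnectedSpace X] {F : Shv k X} (hF : IsLC F) (x : X) :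
    ∃ V : Opens X, x ∈ V ∧ ∀ y (hy : y ∈ V), Function.Bijective (gm F (U := V) y hy) := by
  obtain ⟨U, hU, M, f, hf⟩ := hF x
  obtain ⟨V, hVU, hV, hx, hVc⟩ :=
    locallyConnectedSpace_iff_subsets_isOpen_isConnected.1 ‹_› x U (U.2.mem_nhds hU)
  exact ⟨⟨V, hV⟩, hx, fun y hy => hf.bijective_gm (V := ⟨V, hV⟩) hVU hVc.isPreconnected hy⟩

/-- On a simply connected space, germs of locally constant sheaves extend uniquely to global
sections. -/
lemma IsLC.bijective_gm_top [LocallyConnectedSpace X] (hX : IsSimplyConn X) {F : Shv k X}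
    (hF : IsLC F) (x : X) :
    Function.Bijective (gm F (U := ⊤) x (Opens.mem_top x)) := by
  have hF' := hF.exists_bijective_gm
  constructor
  · intro s t h
    have := hX.1
    have h1 := isOpen_gm_eq s t
    have h2 : IsClopen {x | ∃ (hU : x ∈ (⊤ : Opens X)) (hV : x ∈ (⊤ : Opens X)),
        gm F x hU s = gm F x hV t} := by
      -- Closedness: near `z` there is an open set whose sections are determined by any one germ, so
      -- agreement at one of its points would force agreement at `z`.
      refine ⟨⟨isOpen_iff_mem_nhds.2 fun z hz => ?_⟩, h1⟩
      obtain ⟨V, hzV, hV⟩ := hF' z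
      filter_upwards [V.2.mem_nhds hzV] with y hy
      rintro ⟨_, _, e⟩
      refine hz ⟨trivial, trivial, ?_⟩
      have : res F le_top s = res F le_top t := (hV y hy).1 (by simpa using e)
      rw [← gm_res F le_top hzV, this, gm_res]
    have h3 := h2.eq_univ ⟨x, trivial, trivial, h⟩
    refine sec_ext fun y hy => ?_
    obtain ⟨_, _, e⟩ := (h3 ▸ Set.mem_univ y :)
    exact e
  · intro t
    let P : TopCat.Presheaf (ModuleCat.{u} k) X := F.obj
    obtain ⟨I, _, _, e, he⟩ := hX.2 P.EtaleSpace _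
      (TopCat.Presheaf.EtaleSpace.isCoveringMap_base (F := P) hF')
    -- The étale space is a product `X × I`; `σ` is its horizontal slice through the given germ `t`.
    let σ : X → P.EtaleSpace := fun a => e.symm (a, (e ⟨x, t⟩).2)
    have hσ : Continuous σ := by fun_prop
    have h1 (a : X) : (σ a).base = a := by
      refine (he (σ a)).symm.trans ?_
      simp [σ]
    have h2 : σ x = ⟨x, t⟩ := by
      simp only [σ]
      rw [Homeomorph.symm_apply_eq]
      exact Prod.ext (he ⟨x, t⟩).symm rfl
    -- A continuous section of the étale space is locally given by sections of the sheaf; these are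
    -- then glued to a global one.
    have h3 (z : X) : ∃ U : Opens X, z ∈ U ∧ ∃ s : Sec F U, ∀ a (ha : a ∈ U),
        σ a = ⟨a, gm F a ha s⟩ := by
      obtain ⟨U, hzU, s, hs⟩ :=
        TopCat.Presheaf.EtaleSpace.exists_section_of_tendsto (hσ.tendsto z)
      rw [h1] at hzU
      obtain ⟨V, hVs, hV, hzV⟩ := eventually_nhds_iff.1 hs
      refine ⟨⟨V, hV⟩ ⊓ U, ⟨hzV, hzU⟩, res F (U := U) inf_le_right s, fun a ha => ?_⟩
      obtain ⟨h4, h5⟩ := hVs a ha.1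
      have h6 : σ a = ⟨(σ a).base, gm F (U := U) (σ a).base h4 s⟩ := by
        conv_lhs => rw [show σ a = ⟨(σ a).base, (σ a).germ⟩ from rfl, h5]
        rfl
      refine h6.trans ?_
      have h7 : ∀ (b : X) (hb : b ∈ U) (hab : b = a),
          (⟨b, gm F (U := U) b hb s⟩ : P.EtaleSpace) = ⟨a, gm F (U := U) a ha.2 s⟩ := by
        rintro b hb rfl; rfl
      exact (h7 _ _ (h1 a)).trans (congrArg (TopCat.Presheaf.EtaleSpace.mk (F := P) a)
        (gm_res F (U := U) inf_le_right ha s).symm)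
    choose V hzV s hs using h3
    obtain ⟨T, hT⟩ := exists_glue (F := F) V ⊤ (fun _ => le_top) (fun z _ => ⟨z, hzV z⟩) s
      (fun i j z hi hj => by
        have := (hs i z hi).symm.trans (hs j z hj)
        exact eq_of_heq (TopCat.Presheaf.EtaleSpace.mk.inj this).2)
    refine ⟨T, ?_⟩
    have h4 := (hs x x (hzV x)).symm.trans h2
    rw [← gm_res F le_top (hzV x), hT]
    exact eq_of_heq (TopCat.Presheaf.EtaleSpace.mk.inj h4).2

lemma IsLocallySimplyConn.locallyConnectedSpace (hX : IsLocallySimplyConn X) :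
    LocallyConnectedSpace X := by
  refine locallyConnectedSpace_iff_subsets_isOpen_isConnected.2 fun x U hU => ?_
  obtain ⟨V, hVU, hV, hx, hVs⟩ := hX x U hU
  exact ⟨V, hVU, hV, hx, isConnected_iff_connectedSpace.2 hVs.1⟩

lemma _root_.IsLocalHomeomorph.locallyConnectedSpace {A B : Type*} [TopologicalSpace A]
    [TopologicalSpace B] [LocallyConnectedSpace B] {f : A → B} (hf : IsLocalHomeomorph f) :
    LocallyConnectedSpace A := by
  refine locallyConnectedSpace_iff_subsets_isOpen_isConnected.2 fun x U hU => ?_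
  obtain ⟨t, hx, -⟩ := hf x
  have h1 : t.target ∩ t.symm ⁻¹' (interior U) ∈ 𝓝 (t x) :=
    (t.isOpen_inter_preimage_symm isOpen_interior).mem_nhds
      ⟨t.map_source hx, by simpa [t.left_inv hx] using mem_interior_iff_mem_nhds.2 hU⟩
  obtain ⟨V, hVU, hV, hxV, hVc⟩ :=
    locallyConnectedSpace_iff_subsets_isOpen_isConnected.1 ‹_› _ _ h1
  refine ⟨t.symm '' V, ?_, ?_, ⟨t x, hxV, t.left_inv hx⟩, hVc.image _
    (t.continuousOn_symm.mono fun z hz => (hVU hz).1)⟩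
  · rintro _ ⟨z, hz, rfl⟩
    exact interior_subset (hVU hz).2
  · exact t.symm.isOpen_image_of_subset_source hV fun z hz => (hVU hz).1

end LocallyConstant

/-! ### Constant sheaves, free sheaves and their presentations. -/

section ConstantSheaf

variable {k : Type u} [Ring k] {X : TopCat.{u}}

lemma IsTriv.comp_iso {F G : Shv k X} {U : Opens X} {M : ModuleCat.{u} k} {f : M →ₗ[k] Sec F U}
    (hf : IsTriv F U f) (e : F ⟶ G) [he : IsIso e] : IsTriv G U (ap e U ∘ₗ f) := fun x hx => by
  have := ((isIso_iff_bijective_stMap e).1 inferInstance x).comp (hf x hx)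
  convert this using 1
  exact funext fun m => (stMap_gm _ _ _).symm

/-- The constant sheaf. -/
abbrev cst (X : TopCat.{u}) (M : ModuleCat.{u} k) : Shv k X :=
  (constantSheaf (Opens.grothendieckTopology X) (ModuleCat.{u} k)).obj M

/-- The constant sections of the constant sheaf. -/
def cstSec (X : TopCat.{u}) (M : ModuleCat.{u} k) : M →ₗ[k] Sec (cst X M) ⊤ :=
  ((toSheafify (Opens.grothendieckTopology X) ((Functor.const _).obj M)).app (op ⊤)).hom

/-- The constant presheaf has identity restriction maps, so its stalks are `M`, and sheafification
does not change stalks. -/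
lemma isTriv_cstSec (X : TopCat.{u}) (M : ModuleCat.{u} k) :
    IsTriv (cst X M) ⊤ (cstSec X M) := by
  intro x hx
  let P : TopCat.Presheaf (ModuleCat.{u} k) X := (Functor.const _).obj M
  have h1 : Function.Bijective (P.germ ⊤ x hx).hom := by
    constructor
    · intro m n h
      obtain ⟨W, hW, i, j, e⟩ := P.germ_eq x hx hx m n h
      exact e
    · intro t
      obtain ⟨U, hU, m, rfl⟩ := P.exists_germ_eq t
      exact ⟨m, (P.germ_res_apply (homOfLE le_top) x hU m).symm⟩
  have h2 := TopCat.Presheaf.stalkFunctor_map_unit_toSheafify_isIso x _ P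
  have h3 := ((ConcreteCategory.isIso_iff_bijective
    ((TopCat.Presheaf.stalkFunctor (ModuleCat.{u} k) x).map
      (toSheafify (Opens.grothendieckTopology X) P))).1 h2).comp h1
  exact (congrArg Function.Bijective (funext fun m : M =>
    (TopCat.Presheaf.stalkFunctor_map_germ_apply ⊤ x hx
      (toSheafify (Opens.grothendieckTopology X) P) m).symm)).mpr h3

/-- A linear map `M ⟶ Γ(X, F)` induces a morphism from the constant sheaf to `F`. -/
lemma exists_cst_hom {F : Shv k X} {M : ModuleCat.{u} k} (f : M →ₗ[k] Sec F ⊤) :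
    ∃ g : cst X M ⟶ F, ap g ⊤ ∘ₗ cstSec X M = f := by
  let η : (Functor.const (Opens X)ᵒᵖ).obj M ⟶ F.obj :=
    { app := fun U => ModuleCat.ofHom (res F le_top ∘ₗ f)
      naturality := fun U V i => by
        refine ModuleCat.hom_ext (LinearMap.ext fun m => ?_)
        exact (res_res F (U := ⊤) (V := U.unop) (W := V.unop) le_top i.unop.le (f m)).symm }
  refine ⟨⟨sheafifyLift _ η F.property⟩, LinearMap.ext fun m => ?_⟩
  have := congrArg (fun g => (g.app (op ⊤)).hom m)
    (toSheafify_sheafifyLift (Opens.grothendieckTopology X) η F.property)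
  exact this.trans (res_self F (U := ⊤) le_top (f m))

/-- The morphism from the constant sheaf induced by `f` is bijective on stalks, since both stalks
are identified with `M`. -/
lemma IsTriv.nonempty_iso {F : Shv k X} {M : ModuleCat.{u} k} {f : M →ₗ[k] Sec F ⊤}
    (hf : IsTriv F ⊤ f) : Nonempty (cst X M ≅ F) := by
  obtain ⟨g, hg⟩ := exists_cst_hom f
  have : IsIso g := by
    refine (isIso_iff_bijective_stMap g).2 fun x => ?_
    refine (Function.Bijective.of_comp_iff _ (isTriv_cstSec X M x trivial)).1 ?_
    convert hf x trivial using 1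
    refine funext fun m => (stMap_gm _ _ _).trans (congrArg _ ?_)
    exact LinearMap.congr_fun hg m
  exact ⟨asIso g⟩

variable (k X) in
/-- The constant sheaf functor. -/
def cstFunctor : ModuleCat.{u} k ⥤ Shv k X :=
  constantSheaf (Opens.grothendieckTopology X) (ModuleCat.{u} k)

/-- The constant sheaf functor is left adjoint to sections over `⊤`. Preserving coproducts makes
free sheaves constant; preserving finite limits as well makes the functor exact. -/
instance : PreservesColimitsOfSize.{u, u} (cstFunctor k X) :=
  (constantSheafAdj (Opens.grothendieckTopology X) (ModuleCat.{u} k)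
    isTerminalTop).leftAdjoint_preservesColimits

instance : PreservesFiniteColimits (cstFunctor k X) :=
  PreservesColimitsOfSize.preservesFiniteColimits _

instance : PreservesFiniteLimits (cstFunctor k X) := by
  have : PreservesFiniteLimits (Functor.const (Opens X)ᵒᵖ : ModuleCat.{u} k ⥤ _) := inferInstance
  exact comp_preservesFiniteLimits _ (presheafToSheaf _ _)

/-- The free sheaf is constant. -/
def freeSheafIso (k : Type u) [Ring k] (X : TopCat.{u}) (I : Type u) :
    (cstFunctor k X).obj (∐ fun _ : I => ModuleCat.of k k) ≅ freeSheaf k X I :=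
  have : HasCoproduct fun _ : I => (cstFunctor k X).obj (ModuleCat.of k k) :=
    inferInstanceAs (HasCoproduct fun _ : I => unitSheaf k X)
  PreservesCoproduct.iso (cstFunctor k X) _

lemma exists_isTriv_freeSheaf (I : Type u) :
    ∃ (M : ModuleCat.{u} k) (f : M →ₗ[k] Sec (freeSheaf k X I) ⊤), IsTriv _ _ f :=
  ⟨_, _, (isTriv_cstSec X _).comp_iso (he := (freeSheafIso k X I).isIso_hom) (freeSheafIso k X I).hom⟩

lemma exists_free_epi (M : ModuleCat.{u} k) :
    ∃ g : (∐ fun _ : M => ModuleCat.of k k) ⟶ M, Epi g := by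
  refine ⟨Sigma.desc fun m => ModuleCat.ofHom (LinearMap.toSpanSingleton k M m),
    (ModuleCat.epi_iff_surjective _).2 fun m => ⟨(Sigma.ι (fun _ : M => ModuleCat.of k k) m).hom (1 : k), ?_⟩⟩
  have := congrArg (fun f => f.hom (1 : k)) (Sigma.ι_desc
    (fun m : M => ModuleCat.ofHom (LinearMap.toSpanSingleton k M m)) m)
  exact this.trans (one_smul _ _)

/-- Cover `M` by a free module, then cover the kernel by another one. -/
lemma exists_presentation (M : ModuleCat.{u} k) :
    ∃ (I J : Type u) (f : (∐ fun _ : I => ModuleCat.of k k) ⟶ ∐ fun _ : J => ModuleCat.of k k)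
      (g : (∐ fun _ : J => ModuleCat.of k k) ⟶ M) (w : f ≫ g = 0),
      (ShortComplex.mk f g w).Exact ∧ Epi g := by
  obtain ⟨g, hg⟩ := exists_free_epi M
  obtain ⟨p, hp⟩ := exists_free_epi (kernel g)
  refine ⟨_, _, p ≫ kernel.ι g, g, by simp, ?_, hg⟩
  rw [ShortComplex.exact_iff_epi_kernel_lift]
  convert hp
  rw [← cancel_mono (kernel.ι g)]
  simp

lemma _root_.CategoryTheory.ShortComplex.Exact.exists_conj {C : Type*} [Category* C] [Abelian C]
    {S : ShortComplex C} (h : S.Exact) (hg : Epi S.g) {A B D : C} (a : S.X₁ ≅ A) (b : S.X₂ ≅ B)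
    (d : S.X₃ ≅ D) : ∃ (f : A ⟶ B) (g : B ⟶ D) (w : f ≫ g = 0),
      (ShortComplex.mk f g w).Exact ∧ Epi g := by
  refine ⟨a.inv ≫ S.f ≫ b.hom, b.inv ≫ S.g ≫ d.hom, by simp, ?_, inferInstance⟩
  exact ShortComplex.exact_of_iso (ShortComplex.isoMk a b d (by simp) (by simp)) h

lemma exists_presentation_cst (M : ModuleCat.{u} k) {F : Shv k X} (e : cst X M ≅ F) :
    ∃ (I J : Type u) (f : freeSheaf k X I ⟶ freeSheaf k X J)
      (g : freeSheaf k X J ⟶ F) (w : f ≫ g = 0),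
      (ShortComplex.mk f g w).Exact ∧ Epi g := by
  obtain ⟨I, J, f, g, w, h, hg⟩ := exists_presentation M
  have : (cstFunctor k X).PreservesZeroMorphisms := inferInstance
  exact ⟨I, J, (h.map (cstFunctor k X)).exists_conj (inferInstanceAs (Epi ((cstFunctor k X).map g)))
    (freeSheafIso k X I) (freeSheafIso k X J) e⟩

end ConstantSheaf

/-! ### Quasi-coherent sheaves are the locally constant ones. -/

section Quasicoherent

variable {k : Type u} [Ring k] {X : TopCat.{u}}

lemma surjective_stMap {F G : Shv k X} (g : F ⟶ G) [Epi g] (x : X) :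
    Function.Surjective (stMap g x) :=
  (ModuleCat.epi_iff_surjective _).1
    (inferInstanceAs (Epi ((TopCat.Sheaf.forget (ModuleCat.{u} k) X ⋙
      TopCat.Presheaf.stalkFunctor (ModuleCat.{u} k) x).map g)))

lemma exists_stMap_eq {A B F : Shv k X} {f : A ⟶ B} {g : B ⟶ F} {w : f ≫ g = 0}
    (h : (ShortComplex.mk f g w).Exact) {x : X} {t : St B x} (ht : stMap g x t = 0) :
    ∃ a, stMap f x a = t :=
  (ShortComplex.moduleCat_exact_iff _).1
    ((TopCat.Sheaf.exact_iff_stalkFunctor_map_exact _).1 h x) t ht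

/-- Cokernels of morphisms between constant sheaves are constant on connected open sets. -/
lemma exists_isTriv_of_exact {A B F : Shv k X} {f : A ⟶ B} {g : B ⟶ F} {w : f ≫ g = 0}
    (h : (ShortComplex.mk f g w).Exact) [Epi g] {M N : ModuleCat.{u} k}
    {a : M →ₗ[k] Sec A ⊤} (ha : IsTriv A ⊤ a) {b : N →ₗ[k] Sec B ⊤} (hb : IsTriv B ⊤ b)
    {V : Opens X} (hV : IsConnected (V : Set X)) :
    ∃ (P : ModuleCat.{u} k) (p : P →ₗ[k] Sec F V), IsTriv F V p := by
  obtain ⟨⟨z₀, hz₀⟩, hV⟩ := hV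
  let e : N ≃ₗ[k] St B z₀ := LinearEquiv.ofBijective (gm B (U := ⊤) z₀ (Opens.mem_top z₀) ∘ₗ b) (hb z₀ (Opens.mem_top z₀))
  -- The stalk of `f` at `z₀`, read as a map of modules. By `hα` it describes `f` at every point of
  -- `V`, because sections of `B` over `V` are constant.
  let α : M →ₗ[k] N := e.symm.toLinearMap ∘ₗ gm B (U := ⊤) z₀ (Opens.mem_top z₀) ∘ₗ ap f ⊤ ∘ₗ a
  have hα (m : M) {z : X} (hz : z ∈ V) :
      gm B (U := ⊤) z (Opens.mem_top z) (b (α m)) = gm B (U := ⊤) z (Opens.mem_top z) (ap f ⊤ (a m)) := by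
    have h1 : gm B (U := ⊤) z₀ (Opens.mem_top z₀) (b (α m)) = gm B (U := ⊤) z₀ (Opens.mem_top z₀) (ap f ⊤ (a m)) :=
      e.apply_symm_apply _
    have := hb.gm_eq (V := V) le_top hV (res B le_top (ap f ⊤ (a m))) hz₀ hz
      (m := α m) (by rw [gm_res]; exact h1)
    rwa [gm_res] at this
  let q : N →ₗ[k] Sec F V := res F le_top ∘ₗ ap g ⊤ ∘ₗ b
  have hgf (s : Sec A ⊤) : ap g ⊤ (ap f ⊤ s) = 0 := by rw [← ap_comp, w, ap_zero]
  have hq : LinearMap.range α ≤ LinearMap.ker q := by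
    rintro _ ⟨m, rfl⟩
    refine sec_ext fun z hz => ?_
    simp only [q, LinearMap.comp_apply]
    rw [gm_res, ← stMap_gm, hα m hz, stMap_gm, hgf, map_zero, map_zero]
  -- The value of `F` is `coker α`: at each `z` in `V` the stalk sequence is exact and its first map
  -- is `α`.
  refine ⟨ModuleCat.of k (N ⧸ LinearMap.range α), (LinearMap.range α).liftQ q hq, fun z hz => ?_⟩
  have hqz (n : N) : gm F z hz (q n) = stMap g z (gm B (U := ⊤) z (Opens.mem_top z) (b n)) := by
    simp only [q, LinearMap.comp_apply]
    rw [gm_res, stMap_gm]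
  constructor
  · refine (injective_iff_map_eq_zero (gm F z hz ∘ₗ (LinearMap.range α).liftQ q hq)).2 fun n hn => ?_
    obtain ⟨n, rfl⟩ := Submodule.mkQ_surjective _ n
    have h1 : stMap g z (gm B (U := ⊤) z (Opens.mem_top z) (b n)) = 0 := (hqz n).symm.trans hn
    obtain ⟨t, ht⟩ := exists_stMap_eq h h1
    obtain ⟨m, rfl⟩ := (ha z (Opens.mem_top z)).2 t
    refine (Submodule.Quotient.mk_eq_zero _).2 ⟨m, ?_⟩
    refine (hb z trivial).1 ((hα m hz).trans ?_)
    exact (stMap_gm _ _ _).symm.trans ht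
  · intro t
    obtain ⟨t, rfl⟩ := surjective_stMap g z t
    obtain ⟨n, rfl⟩ := (hb z trivial).2 t
    exact ⟨Submodule.Quotient.mk n, hqz n⟩

/-! ### Restriction to open subsets -/

/-- The image in `X` of an open subset of the open subset `U`. -/
def img {U : Opens X} (W : Opens (TopCat.of U)) : Opens X :=
  ((Opens.isOpenEmbedding' U).functor (f := U.inclusion')).obj W

lemma mem_img {U : Opens X} {W : Opens (TopCat.of U)} {x : U} : x.1 ∈ img W ↔ x ∈ W := by
  constructor
  · rintro ⟨y, hy, e⟩
    obtain rfl : y = x := Subtype.ext e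
    exact hy
  · exact fun h => ⟨x, h, rfl⟩

lemma img_le {U : Opens X} (W : Opens (TopCat.of U)) : img W ≤ U := by
  rintro _ ⟨y, -, rfl⟩
  exact y.2

/-- Sections of the restriction of a sheaf. -/
def secRestrict (F : Shv k X) {U : Opens X} (W : Opens (TopCat.of U)) :
    Sec F (img W) ≃ₗ[k] Sec ((restrict k U).obj F) W := LinearEquiv.refl _ _

lemma img_mono {U : Opens X} {W W' : Opens (TopCat.of U)} (h : W ≤ W') : img W ≤ img W' :=
  (((Opens.isOpenEmbedding' U).functor (f := U.inclusion')).map (homOfLE h)).le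

lemma secRestrict_res (F : Shv k X) {U : Opens X} {W W' : Opens (TopCat.of U)} (h : W ≤ W')
    (s : Sec F (img W')) : secRestrict F W (res F (img_mono h) s) =
      res ((restrict k U).obj F) h (secRestrict F W' s) := rfl

/-- Neighbourhoods of `x` in `U` and in `X` are cofinal in each other. Comparing equalities of germs
is enough for `IsTriv`, so the stalks themselves need not be identified. -/
lemma gm_secRestrict_eq_iff (F : Shv k X) {U : Opens X} {W W' : Opens (TopCat.of U)} {x : U}
    (hW : x ∈ W) (hW' : x ∈ W') (s : Sec F (img W)) (t : Sec F (img W')) :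
    gm ((restrict k U).obj F) (X := TopCat.of U) x hW (secRestrict F W s) =
      gm ((restrict k U).obj F) (X := TopCat.of U) x hW' (secRestrict F W' t) ↔
    gm F x.1 (mem_img.2 hW) s = gm F x.1 (mem_img.2 hW') t := by
  constructor
  · intro h
    obtain ⟨V, hV, h1, h2, e⟩ := exists_res_eq h
    rw [← secRestrict_res, ← secRestrict_res] at e
    rw [← gm_res F (img_mono h1) (mem_img.2 hV), (secRestrict F V).injective e, gm_res]
  · intro h
    obtain ⟨V, hV, h1, h2, e⟩ := exists_res_eq h
    let V' : Opens (TopCat.of U) := (Opens.map U.inclusion').obj V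
    have hV' : x ∈ V' := hV
    have hle : img V' ≤ V := by
      rintro _ ⟨y, hy, rfl⟩
      exact hy
    have h1' : V' ≤ W := fun y hy => mem_img.1 (h1 hy)
    have h2' : V' ≤ W' := fun y hy => mem_img.1 (h2 hy)
    rw [← gm_res _ h1' hV', ← gm_res _ h2' hV', ← secRestrict_res, ← secRestrict_res,
      ← res_res F h1 hle, e, res_res]

lemma IsTriv.of_restrict {F : Shv k X} {U : Opens X} {W : Opens (TopCat.of U)}
    {M : ModuleCat.{u} k} {f : M →ₗ[k] Sec ((restrict k U).obj F) W}
    (hf : IsTriv _ W f) : IsTriv F (img W) ((secRestrict F W).symm.toLinearMap ∘ₗ f) := by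
  rintro _ ⟨x, hx, rfl⟩
  have hx' : (x : U) ∈ W := hx
  constructor
  · intro m n h
    refine (hf x hx).1 ?_
    exact (gm_secRestrict_eq_iff F (x := x) hx' hx' _ _).2 h
  · intro t
    obtain ⟨V, hV, s, rfl⟩ := exists_gm_eq t
    let V' : Opens (TopCat.of U) := (Opens.map U.inclusion').obj V
    have hle : img V' ≤ V := by
      rintro _ ⟨y, hy, rfl⟩
      exact hy
    obtain ⟨m, hm⟩ := (hf x hx).2 (gm ((restrict k U).obj F) (U := V') x hV
      (secRestrict F V' (res F hle s)))
    refine ⟨m, ?_⟩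
    refine ((gm_secRestrict_eq_iff F (x := x) hx' hV _ _).1 hm).trans ?_
    exact gm_res F hle _ s

lemma IsTriv.restrict {F : Shv k X} {U : Opens X} {M : ModuleCat.{u} k} {f : M →ₗ[k] Sec F U}
    (hf : IsTriv F U f) :
    IsTriv ((restrict k U).obj F) ⊤ ((secRestrict F ⊤).toLinearMap ∘ₗ res F (img_le ⊤) ∘ₗ f) := by
  intro x hx
  constructor
  · intro m n h
    have := (gm_secRestrict_eq_iff F (W := ⊤) (W' := ⊤) (x := x) trivial trivial _ _).1 h
    refine (hf x.1 x.2).1 ?_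
    exact (gm_res F (img_le ⊤) (mem_img.2 hx) (f m)).symm.trans
      (this.trans (gm_res F (img_le ⊤) (mem_img.2 hx) (f n)))
  · intro t
    obtain ⟨V, hV, s, rfl⟩ := exists_gm_eq t
    obtain ⟨m, hm⟩ := (hf x.1 x.2).2 (gm F x.1 (mem_img.2 hV) ((secRestrict F V).symm s))
    refine ⟨m, ?_⟩
    refine (gm_secRestrict_eq_iff F (W := ⊤) (x := x) (W' := V) trivial hV _ ((secRestrict F V).symm s)).2 ?_
    exact (gm_res F (img_le ⊤) (mem_img.2 hx) (f m)).trans hm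

lemma IsLC.isQuasicoherent {F : Shv k X} (hF : IsLC F) : isQuasicoherent k X F := by
  intro x
  obtain ⟨U, hx, M, f, hf⟩ := hF x
  obtain ⟨e⟩ := hf.restrict.nonempty_iso
  exact ⟨U, hx, exists_presentation_cst M e⟩

/-- Over a connected open subset of the domain of a presentation, `F` is a cokernel of constant
sheaves, hence constant. -/
lemma isLC_of_isQuasicoherent [LocallyConnectedSpace X] {F : Shv k X}
    (hF : isQuasicoherent k X F) : IsLC F := by
  intro x
  obtain ⟨U, hx, I, J, f, g, w, h, hg⟩ := hF x
  obtain ⟨M, a, ha⟩ := exists_isTriv_freeSheaf (k := k) (X := TopCat.of U) I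
  obtain ⟨N, b, hb⟩ := exists_isTriv_freeSheaf (k := k) (X := TopCat.of U) J
  have : LocallyConnectedSpace (TopCat.of U) := U.2.locallyConnectedSpace
  obtain ⟨V, -, hV, hxV, hVc⟩ := locallyConnectedSpace_iff_subsets_isOpen_isConnected.1 this
    ⟨x, hx⟩ Set.univ Filter.univ_mem
  obtain ⟨P, p, hp⟩ := exists_isTriv_of_exact h ha hb (V := ⟨V, hV⟩) hVc
  exact ⟨img ⟨V, hV⟩, mem_img (x := ⟨x, hx⟩).2 hxV, P, _, hp.of_restrict⟩

end Quasicoherent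

/-! ### Germs of global sections of `φ⁻¹ L` -/

section GlobalSections

variable {k : Type u} [Ring k] {Y X : TopCat.{u}} (φ : Y ⟶ X)

/-- The germ of a global section of `φ⁻¹ L`. -/
def ggm (L : Shv k X) (y : Y) : (globalSections k φ).obj L →ₗ[k] St (inv φ L) y :=
  gm (inv φ L) (U := ⊤) y (Opens.mem_top y)

variable {φ}

lemma ggm_ext {L : Shv k X} {s t : (globalSections k φ).obj L}
    (h : ∀ y, ggm φ L y s = ggm φ L y t) : s = t :=
  sec_ext (F := inv φ L) (U := ⊤) fun y _ => h y

lemma isOpen_ggm_eq {L : Shv k X} {V : Opens Y} (s : (globalSections k φ).obj L)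
    (t : Sec (inv φ L) V) :
    IsOpen {y | ∃ hy : y ∈ V, ggm φ L y s = gm (inv φ L) y hy t} := by
  convert isOpen_gm_eq (F := inv φ L) (U := ⊤) s t using 1
  ext y
  exact ⟨fun ⟨h1, h2⟩ => ⟨trivial, h1, h2⟩, fun ⟨_, h1, h2⟩ => ⟨h1, h2⟩⟩

lemma ggm_map {L L' : Shv k X} (f : L ⟶ L') (y : Y) (t : (globalSections k φ).obj L) :
    ggm φ L' y (((globalSections k φ).map f).hom t) =
      stMap ((TopCat.Sheaf.pullback (ModuleCat.{u} k) φ).map f) y (ggm φ L y t) :=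
  (stMap_gm ((TopCat.Sheaf.pullback (ModuleCat.{u} k) φ).map f) (U := ⊤) (Opens.mem_top y) t).symm

/-- Pullback of sections of `φ⁻¹ L` along a map over `X`. -/
def pullSec (h : Y ⟶ Y) (w : h ≫ φ = φ) (L : Shv k X) (V : Opens Y) :
    Sec (inv φ L) V →ₗ[k] Sec (inv φ L) ((Opens.map h).obj V) :=
  ((pullSections k φ h w L).hom.app (op V)).hom

lemma pullSec_res (h : Y ⟶ Y) (w : h ≫ φ = φ) (L : Shv k X) {V W : Opens Y} (hVW : W ≤ V)
    (s : Sec (inv φ L) V) : pullSec h w L W (res _ hVW s) =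
      res (inv φ L) (U := (Opens.map h).obj V) (V := (Opens.map h).obj W) (fun _ hy => hVW hy)
        (pullSec h w L V s) :=
  congrArg (fun f => f.hom s) ((pullSections k φ h w L).hom.naturality (homOfLE hVW).op)

/-- The adjunction formula defining `pullSections`, evaluated on a section: what comes from `X` is
unchanged by a map over `X`. -/
lemma pullSec_pb (h : Y ⟶ Y) (w : h ≫ φ = φ) (L : Shv k X) {U : Opens X} (s : Sec L U)
    (hU : (Opens.map h).obj ((Opens.map φ).obj U) ≤ (Opens.map φ).obj U) :
    pullSec h w L _ (pb φ L U s) = res (inv φ L) hU (pb φ L U s) := by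
  have h1 := (Adjunction.homEquiv_unit
    (TopCat.Sheaf.pullbackPushforwardAdjunction (ModuleCat.{u} k) φ) _ _
      (pullSections k φ h w L)).symm.trans (homEquiv_pullSections k φ h w L)
  have h2 := congrArg (fun f => (f.hom.app (op U)).hom s) h1
  exact h2

/-- Sections of `φ⁻¹ L` come locally from `L`, so `pullSec_pb` determines pullback on germs: `s`
represents the germ at `z` as it did at `h z`. The point `y` is kept separate from `h z` to allow
equalities that are not definitional. -/
lemma gm_pullSec (h : Y ⟶ Y) (w : h ≫ φ = φ) (L : Shv k X) {V : Opens Y} (t : Sec (inv φ L) V)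
    {U : Opens X} (s : Sec L U) {y z : Y} (hz : h z = y) (hV : y ∈ V) (hU : φ y ∈ U)
    (hV' : z ∈ (Opens.map h).obj V) (hU' : φ z ∈ U)
    (e : gm (inv φ L) y hV t = gm (inv φ L) (U := (Opens.map φ).obj U) y hU (pb φ L U s)) :
    gm (inv φ L) z hV' (pullSec h w L V t) =
      gm (inv φ L) (U := (Opens.map φ).obj U) z hU' (pb φ L U s) := by
  subst hz
  obtain ⟨W, hW, h1, h2, e⟩ := exists_res_eq e
  have hle : (Opens.map h).obj ((Opens.map φ).obj U) ≤ (Opens.map φ).obj U := by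
    intro x hx
    have : φ (h x) = φ x := congrArg (fun f : Y ⟶ X => f x) w
    change φ (h x) ∈ U at hx
    rwa [this] at hx
  have e' := congrArg (pullSec h w L W) e
  rw [pullSec_res, pullSec_res, pullSec_pb h w L s hle] at e'
  have hW' : z ∈ (Opens.map h).obj W := hW
  refine (gm_res (inv φ L) (U := (Opens.map h).obj V) (fun _ hy => h1 hy) hW' (pullSec h w L V t)).symm.trans ?_
  refine (congrArg (gm (inv φ L) z hW') e').trans ?_
  refine (gm_res (inv φ L) (U := (Opens.map h).obj ((Opens.map φ).obj U)) (fun _ hy => h2 hy) hW'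
    (res (inv φ L) hle (pb φ L U s))).trans ?_
  exact gm_res (inv φ L) hle _ _

/-- Since `g` acts by pullback along `g⁻¹`, the germ of `g t` at `g y` and that of `t` at `y` are
the same element of the stalk of `L`. -/
lemma ggm_ρ {L : Shv k X} (g : Deck φ) {y : Y} {t : (globalSections k φ).obj L} {U : Opens X}
    {s : Sec L U} (hy : φ y ∈ U) (hgy : φ (g • y) ∈ U)
    (e : ggm φ L y t = gm (inv φ L) (U := (Opens.map φ).obj U) y hy (pb φ L U s)) :
    ggm φ L (g • y) (((globalSections k φ).obj L).ρ g t) =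
      gm (inv φ L) (U := (Opens.map φ).obj U) (g • y) hgy (pb φ L U s) :=
  gm_pullSec (V := ⊤) g⁻¹.hom.left (Over.w g⁻¹.hom) L t s (inv_smul_smul g y) trivial hy trivial
    hgy e

/-- Germs of global sections, when `φ⁻¹ L` is constant. -/
lemma bijective_ggm [LocallyConnectedSpace X] (hφ : IsUniversalCovering φ) {L : Shv k X}
    (hL : IsLC L) (y : Y) : Function.Bijective (ggm φ L y) := by
  have := hφ.isCoveringMap.isLocalHomeomorph.locallyConnectedSpace
  exact (hL.inv φ).bijective_gm_top hφ.isSimplyConn y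

/-- The identification of global sections with germs, when `φ⁻¹ L` is constant. -/
def ggmEquiv [LocallyConnectedSpace X] (hφ : IsUniversalCovering φ) {L : Shv k X}
    (hL : IsLC L) (y : Y) : (globalSections k φ).obj L ≃ₗ[k] St (inv φ L) y :=
  LinearEquiv.ofBijective (ggm φ L y) (bijective_ggm hφ hL y)

end GlobalSections

/-! ### Germs of sections of `(Y × E)/G` -/

section AssociatedSheaf

variable {k : Type u} [Ring k] {Y X : TopCat.{u}} {φ : Y ⟶ X} (hφ : IsUniversalCovering φ)
  (E : Rep.{u} k (Deck φ))

lemma fibLinearEquiv_smul (g : Deck φ) (y : Y) {x : X} (hy : φ y = x) (hgy : φ (g • y) = x)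
    (e : E) : fibLinearEquiv hφ E (g • y) hgy (E.ρ g e) = fibLinearEquiv hφ E y hy e :=
  Subtype.ext (Total.mk_eq_iff.2 ⟨g, rfl, rfl⟩)

/-- The value of a section of `(Y × E)/G`. -/
def val {U : Opens X} : Sec ((associatedSheaf k hφ).obj E) U →ₗ[k] ∀ x : U, Fib hφ E x :=
  (contSections hφ E U).subtype

variable {E} in
/-- Continuous sections of `(Y × E)/G` are sections of the associated sheaf. -/
def mkSec {U : Opens X} (s : ∀ x : U, Fib hφ E x) (hs : Continuous fun x : U => (s x).1) :
    Sec ((associatedSheaf k hφ).obj E) U :=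
  (⟨s, hs⟩ : contSections hφ E U)

@[simp] lemma val_mkSec {U : Opens X} (s : ∀ x : U, Fib hφ E x)
    (hs : Continuous fun x : U => (s x).1) : val hφ E (mkSec hφ s hs) = s := rfl

lemma val_injective {U : Opens X} : Function.Injective (val hφ E (U := U)) :=
  Subtype.val_injective

lemma val_ap {E' : Rep.{u} k (Deck φ)} (f : E ⟶ E') {U : Opens X}
    (s : Sec ((associatedSheaf k hφ).obj E) U) (x : U) :
    val hφ E' (ap ((associatedSheaf k hφ).map f) U s) x = Fib.map hφ f x.1 (val hφ E s x) := rfl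

lemma fibMap_fibLinearEquiv {E' : Rep.{u} k (Deck φ)} (f : E ⟶ E') (y : Y) {x : X} (hy : φ y = x)
    (e : E) : Fib.map hφ f x (fibLinearEquiv hφ E y hy e) =
      fibLinearEquiv hφ E' y hy (f.hom e) := rfl

variable {E}

lemma val_continuous {U : Opens X} (s : Sec ((associatedSheaf k hφ).obj E) U) :
    Continuous fun x : U => (val hφ E s x).1 :=
  Subtype.prop (p := (· ∈ contSections hφ E U)) s

/-- `continuous_section_iff` gives a local constant value, which evaluation at `y` forces to be `e`.
-/
lemma eventually_val_eq {U : Opens X} (s : Sec ((associatedSheaf k hφ).obj E) U) {y : Y}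
    (hy : φ y ∈ U) {e : E} (h : val hφ E s ⟨φ y, hy⟩ = fibLinearEquiv hφ E y rfl e) :
    ∀ᶠ z in 𝓝 y, ∀ hz : φ z ∈ U, val hφ E s ⟨φ z, hz⟩ = fibLinearEquiv hφ E z rfl e := by
  obtain ⟨e', he'⟩ := (continuous_section_iff hφ E (val hφ E s)).1 (val_continuous hφ s) y hy
  obtain rfl : e = e' := (fibLinearEquiv hφ E y rfl).injective (h.symm.trans (he'.self_of_nhds hy))
  exact he'

/-- Germs of sections of `(Y × E)/G` are determined by their values. -/
lemma gm_eq_iff_val_eq {U V : Opens X} (s : Sec ((associatedSheaf k hφ).obj E) U)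
    (t : Sec ((associatedSheaf k hφ).obj E) V) {x : X} (hU : x ∈ U) (hV : x ∈ V) :
    gm _ x hU s = gm _ x hV t ↔ val hφ E s ⟨x, hU⟩ = val hφ E t ⟨x, hV⟩ := by
  constructor
  · intro h
    obtain ⟨W, hW, h1, h2, e⟩ := exists_res_eq h
    exact congrArg (fun s => val hφ E s ⟨x, hW⟩) e
  · intro h
    obtain ⟨y, rfl⟩ := hφ.surjective x
    obtain ⟨e, he⟩ := (fibLinearEquiv hφ E y rfl).surjective (val hφ E s ⟨φ y, hU⟩)
    have h1 := eventually_val_eq hφ s hU he.symm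
    have h2 := eventually_val_eq hφ t hV (h.symm.trans he.symm)
    -- Both sections are `φ z ↦ [z, e]` for `z` near `y`, and `φ` carries neighbourhoods of `y` to
    -- neighbourhoods of `φ y`.
    have h3 : ∀ᶠ x in 𝓝 (φ y), ∀ (hU : x ∈ U) (hV : x ∈ V),
        val hφ E s ⟨x, hU⟩ = val hφ E t ⟨x, hV⟩ := by
      rw [← hφ.isCoveringMap.isLocalHomeomorph.map_nhds_eq y, Filter.eventually_map]
      filter_upwards [h1, h2] with z h1 h2 hU hV
      rw [h1, h2]
    obtain ⟨W, hWs, hW, hxW⟩ := eventually_nhds_iff.1 h3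
    let W' : Opens X := ⟨W, hW⟩ ⊓ (U ⊓ V)
    have hW'U : W' ≤ U := inf_le_right.trans inf_le_left
    have hW'V : W' ≤ V := inf_le_right.trans inf_le_right
    have hxW' : φ y ∈ W' := ⟨hxW, hU, hV⟩
    have : res _ hW'U s = res _ hW'V t := val_injective hφ E (funext fun x => hWs x x.2.1 _ _)
    rw [← gm_res _ hW'U hxW', this, gm_res]

variable (E)

/-- The associated sheaf is locally constant. -/
lemma exists_isTriv_associatedSheaf (y : Y) :
    ∃ (U : Opens X) (hy : φ y ∈ U)
      (f : ModuleCat.of k E →ₗ[k] Sec ((associatedSheaf k hφ).obj E) U), IsTriv _ U f ∧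
        ∀ e : E, val hφ E (f e) ⟨φ y, hy⟩ = fibLinearEquiv hφ E y rfl e := by
  obtain ⟨t, hy, ht⟩ := hφ.isCoveringMap.isLocalHomeomorph y
  let U : Opens X := ⟨t.target, t.open_target⟩
  have hU (x : U) : φ (t.symm x) = x.1 := by
    rw [ht]; exact t.right_inv x.2
  -- A local section `t.symm` of `φ` trivializes the bundle through `x ↦ [t.symm x, e]`.
  let f : E →ₗ[k] Sec ((associatedSheaf k hφ).obj E) U :=
    { toFun := fun e => mkSec hφ (fun x => fibLinearEquiv hφ E (t.symm x) (hU x) e)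
        ((Total.continuous_mk e).comp t.continuousOn_symm.domRestrict)
      map_add' := fun a b => val_injective hφ E (funext fun x =>
        map_add (fibLinearEquiv hφ E (t.symm x) (hU x)) a b)
      map_smul' := fun c a => val_injective hφ E (funext fun x =>
        map_smul (fibLinearEquiv hφ E (t.symm x) (hU x)) c a) }
  have hf (e : E) (x : U) : val hφ E (f e) x = fibLinearEquiv hφ E (t.symm x) (hU x) e := rfl
  have hyU : φ y ∈ U := by
    rw [ht]; exact t.map_source hy
  refine ⟨U, hyU, f, fun x hx => ⟨fun a b h => ?_, fun s => ?_⟩, fun e => ?_⟩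
  · have := (gm_eq_iff_val_eq hφ _ _ hx hx).1 h
    rw [hf, hf] at this
    exact (fibLinearEquiv hφ E _ _).injective this
  · obtain ⟨V, hV, s, rfl⟩ := exists_gm_eq s
    obtain ⟨e, he⟩ := (fibLinearEquiv hφ E _ (hU ⟨x, hx⟩)).surjective (val hφ E s ⟨x, hV⟩)
    exact ⟨e, (gm_eq_iff_val_eq hφ _ _ hx hV).2 he⟩
  · have : t.symm (φ y) = y := by rw [ht]; exact t.left_inv hy
    exact Subtype.ext (congrArg (fun y => Total.mk y e) this)

lemma isLC_associatedSheaf : IsLC ((associatedSheaf k hφ).obj E) := by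
  intro x
  obtain ⟨y, rfl⟩ := hφ.surjective x
  obtain ⟨U, hy, f, hf, -⟩ := exists_isTriv_associatedSheaf hφ E y
  exact ⟨U, hy, _, f, hf⟩

end AssociatedSheaf

/-! ### The associated sheaf of `Γ(Y, φ⁻¹ L)` -/

section Counit

variable {k : Type u} [Ring k] {Y X : TopCat.{u}} {φ : Y ⟶ X} (hφ : IsUniversalCovering φ)
  [LocallyConnectedSpace X] {L : Shv k X} (hL : IsLC L)

/-- The global section of `φ⁻¹ L` with the same germ at `y` as the pullback of a section `s`. -/
def extSec {U : Opens X} (y : Y) (hy : φ y ∈ U) : Sec L U →ₗ[k] (globalSections k φ).obj L :=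
  (ggmEquiv hφ hL y).symm.toLinearMap ∘ₗ
    gm (inv φ L) (U := (Opens.map φ).obj U) y hy ∘ₗ pb φ L U

lemma ggm_extSec {U : Opens X} (y : Y) (hy : φ y ∈ U) (s : Sec L U) :
    ggm φ L y (extSec hφ hL y hy s) =
      gm (inv φ L) (U := (Opens.map φ).obj U) y hy (pb φ L U s) :=
  (ggmEquiv hφ hL y).apply_symm_apply _

lemma eq_extSec_iff {U : Opens X} {y : Y} {hy : φ y ∈ U} {s : Sec L U}
    {t : (globalSections k φ).obj L} : t = extSec hφ hL y hy s ↔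
      ggm φ L y t = gm (inv φ L) (U := (Opens.map φ).obj U) y hy (pb φ L U s) := by
  rw [← ggm_extSec hφ hL]
  exact (bijective_ggm hφ hL y).1.eq_iff.symm

lemma extSec_smul {U : Opens X} (g : Deck φ) (y : Y) (hy : φ y ∈ U) (hgy : φ (g • y) ∈ U)
    (s : Sec L U) : extSec hφ hL (g • y) hgy s =
      ((globalSections k φ).obj L).ρ g (extSec hφ hL y hy s) := by
  symm
  rw [eq_extSec_iff]
  exact ggm_ρ g hy hgy (ggm_extSec hφ hL y hy s)

/-- The section of `(Y × Γ(Y, φ⁻¹ L))/G` associated to a section of `L`. -/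
def toSections {U : Opens X} (s : Sec L U) (x : U) : Fib hφ ((globalSections k φ).obj L) x :=
  fibLinearEquiv hφ _ (hφ.surjective x.1).choose (hφ.surjective x.1).choose_spec
    (extSec hφ hL _ (by rw [(hφ.surjective x.1).choose_spec]; exact x.2) s)

/-- Independence of the chosen point over `x`: any other one is `g y`, which replaces the extension
`e` by `g e`, and `[g y, g e] = [y, e]`. -/
lemma toSections_apply {U : Opens X} (s : Sec L U) {y : Y} (hy : φ y ∈ U) :
    toSections hφ hL s ⟨φ y, hy⟩ = fibLinearEquiv hφ _ y rfl (extSec hφ hL y hy s) := by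
  have key : ∀ (y' : Y) (h : φ y' = φ y) (hy' : φ y' ∈ U),
      fibLinearEquiv hφ ((globalSections k φ).obj L) y' h (extSec hφ hL y' hy' s) =
        fibLinearEquiv hφ _ y rfl (extSec hφ hL y hy s) := by
    intro y' h hy'
    obtain ⟨g, rfl⟩ := hφ.smul_transitive h.symm
    rw [extSec_smul hφ hL g y hy]
    exact fibLinearEquiv_smul hφ _ g y rfl h _
  exact key _ _ _

lemma continuous_toSections {U : Opens X} (s : Sec L U) :
    Continuous fun x : U => (toSections hφ hL s x).1 := by
  refine (continuous_section_iff hφ _ _).2 fun y hy => ⟨extSec hφ hL y hy s, ?_⟩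
  -- The global extension built at `y` agrees with the pullback of `s` near `y`, so it is also the
  -- extension built at nearby `z`.
  filter_upwards [(isOpen_ggm_eq (extSec hφ hL y hy s) (V := (Opens.map φ).obj U)
    (pb φ L U s)).mem_nhds ⟨hy, ggm_extSec hφ hL y hy s⟩] with z hz hzU
  obtain ⟨_, hz⟩ := hz
  rw [toSections_apply, ← (eq_extSec_iff hφ hL).2 hz]

/-- The morphism from `L` to the associated sheaf of `Γ(Y, φ⁻¹ L)`. -/
def toAssociated : L ⟶ (associatedSheaf k hφ).obj ((globalSections k φ).obj L) :=
  homMk (fun U =>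
    { toFun := fun s => mkSec hφ (toSections hφ hL s) (continuous_toSections hφ hL s)
      map_add' := fun s t => val_injective hφ _ (funext fun x => by
        rw [map_add, val_mkSec, val_mkSec, val_mkSec, Pi.add_apply]
        simp only [toSections, map_add])
      map_smul' := fun c s => val_injective hφ _ (funext fun x => by
        rw [map_smul, val_mkSec, val_mkSec, Pi.smul_apply]
        simp only [toSections, map_smul, RingHom.id_apply]) })
    (fun U V h s => val_injective hφ _ (funext fun x => by
      obtain ⟨x, hx⟩ := x
      obtain ⟨y, rfl⟩ := hφ.surjective x
      refine (toSections_apply hφ hL _ hx).trans (.trans ?_ (toSections_apply hφ hL s (h hx)).symm)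
      congr 1
      rw [eq_extSec_iff, ggm_extSec, pb_res]
      exact gm_res (inv φ L) (U := (Opens.map φ).obj U) (V := (Opens.map φ).obj V) _ hx _))

lemma val_toAssociated {U : Opens X} (s : Sec L U) {y : Y} (hy : φ y ∈ U) :
    val hφ _ (ap (toAssociated hφ hL) U s) ⟨φ y, hy⟩ =
      fibLinearEquiv hφ _ y rfl (extSec hφ hL y hy s) :=
  toSections_apply hφ hL s hy

lemma isIso_toAssociated : IsIso (toAssociated hφ hL) := by
  refine (isIso_iff_bijective_stMap _).2 fun x => ?_
  obtain ⟨y, rfl⟩ := hφ.surjective x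
  constructor
  · refine (injective_iff_map_eq_zero _).2 fun t ht => ?_
    obtain ⟨U, hy, s, rfl⟩ := exists_gm_eq t
    rw [stMap_gm, ← map_zero (gm _ (φ y) hy), gm_eq_iff_val_eq, val_toAssociated, map_zero] at ht
    have h1 := ((fibLinearEquiv hφ _ y rfl).map_eq_zero_iff.1 ht).symm
    rw [eq_extSec_iff, map_zero, ← stPb_gm] at h1
    exact (stPb φ L y).map_eq_zero_iff.1 h1.symm
  · intro t
    obtain ⟨U, hy, s, rfl⟩ := exists_gm_eq t
    obtain ⟨e, he⟩ := (fibLinearEquiv hφ _ y rfl).surjective (val hφ _ s ⟨φ y, hy⟩)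
    -- The preimage of the germ with value `[y, e]` is the germ of `L` whose pullback is the germ of
    -- `e` at `y`.
    obtain ⟨W, hW, s', hs'⟩ := exists_gm_pb L (ggm φ L y e)
    refine ⟨gm L (φ y) hW s', ?_⟩
    rw [stMap_gm, gm_eq_iff_val_eq, val_toAssociated, ← he, ← (eq_extSec_iff hφ hL).2 hs'.symm]

end Counit

section CounitNaturality

variable {k : Type u} [Ring k] {Y X : TopCat.{u}} {φ : Y ⟶ X} (hφ : IsUniversalCovering φ)
  [LocallyConnectedSpace X] {L L' : Shv k X} (hL : IsLC L) (hL' : IsLC L')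

lemma toAssociated_naturality (f : L ⟶ L') :
    f ≫ toAssociated hφ hL' =
      toAssociated hφ hL ≫ (associatedSheaf k hφ).map ((globalSections k φ).map f) := by
  refine hom_ext_ap fun U s => val_injective hφ _ (funext fun ⟨x, hx⟩ => ?_)
  obtain ⟨y, rfl⟩ := hφ.surjective x
  rw [ap_comp, ap_comp, val_toAssociated, val_ap, val_toAssociated]
  refine .trans ?_ (fibMap_fibLinearEquiv hφ _ ((globalSections k φ).map f) y rfl _).symm
  congr 1
  symm
  rw [eq_extSec_iff, ggm_map, ggm_extSec, stMap_gm_pb]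

end CounitNaturality

/-! ### Global sections of the inverse image of the associated sheaf -/

section Unit

variable {k : Type u} [Ring k] {Y X : TopCat.{u}} {φ : Y ⟶ X} (hφ : IsUniversalCovering φ)
  (E : Rep.{u} k (Deck φ))

/-- The composite of a local trivialization with `stPb`. The characterization by values makes it
independent of the trivialization. -/
lemma exists_fibGerm (y : Y) : ∃ e : E ≃ₗ[k] St (inv φ ((associatedSheaf k hφ).obj E)) y,
    ∀ (U : Opens X) (hy : φ y ∈ U) (s : Sec ((associatedSheaf k hφ).obj E) U) (a : E),
      e a = gm (inv φ _) (U := (Opens.map φ).obj U) y hy (pb φ _ U s) ↔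
        val hφ E s ⟨φ y, hy⟩ = fibLinearEquiv hφ E y rfl a := by
  obtain ⟨U, hy, f, hf, hfv⟩ := exists_isTriv_associatedSheaf hφ E y
  let e₀ : E ≃ₗ[k] St ((associatedSheaf k hφ).obj E) (φ y) :=
    LinearEquiv.ofBijective (gm _ (φ y) hy ∘ₗ f) (hf _ hy)
  refine ⟨e₀ ≪≫ₗ stPb φ _ y, fun V hV s a => ?_⟩
  rw [← stPb_gm, LinearEquiv.trans_apply, (stPb φ _ y).injective.eq_iff, ← hfv a]
  exact (gm_eq_iff_val_eq hφ (f a) s hy hV).trans eq_comm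

/-- The identification of `E` with the stalks of the inverse image of the associated sheaf. -/
def fibGerm (y : Y) : E ≃ₗ[k] St (inv φ ((associatedSheaf k hφ).obj E)) y :=
  (exists_fibGerm hφ E y).choose

lemma fibGerm_eq_iff {y : Y} {U : Opens X} (hy : φ y ∈ U)
    (s : Sec ((associatedSheaf k hφ).obj E) U) (a : E) :
    fibGerm hφ E y a = gm (inv φ _) (U := (Opens.map φ).obj U) y hy (pb φ _ U s) ↔
      val hφ E s ⟨φ y, hy⟩ = fibLinearEquiv hφ E y rfl a :=
  (exists_fibGerm hφ E y).choose_spec U hy s a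

variable {E} in
lemma isOpen_fibGerm_eq (t : (globalSections k φ).obj ((associatedSheaf k hφ).obj E)) (a : E) :
    IsOpen {y | fibGerm hφ E y a = ggm φ _ y t} := by
  rw [isOpen_iff_mem_nhds]
  intro y hy
  obtain ⟨U, hU, s, hs⟩ := exists_gm_pb _ (ggm φ _ y t)
  have h1 := (fibGerm_eq_iff hφ E hU s a).1 (hy.trans hs.symm)
  filter_upwards [eventually_val_eq hφ s hU h1, (isOpen_ggm_eq t (V := (Opens.map φ).obj U)
    (pb φ _ U s)).mem_nhds ⟨hU, hs.symm⟩] with z h2 h3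
  obtain ⟨hzU, h3⟩ := h3
  exact ((fibGerm_eq_iff hφ E hzU s a).2 (h2 hzU)).trans h3.symm

variable {E} in
-- Read through `fibGerm`, a global section is a locally constant function `Y → E`, hence constant
-- as `Y` is connected.
lemma fibGerm_eq (t : (globalSections k φ).obj ((associatedSheaf k hφ).obj E)) {a : E} {y : Y}
    (h : fibGerm hφ E y a = ggm φ _ y t) (z : Y) : fibGerm hφ E z a = ggm φ _ z t := by
  have := hφ.isSimplyConn.1
  have h1 : IsClopen {y | fibGerm hφ E y a = ggm φ _ y t} := by
    refine ⟨⟨?_⟩, isOpen_fibGerm_eq hφ t a⟩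
    have : {y | fibGerm hφ E y a = ggm φ _ y t}ᶜ =
        ⋃ b : {b // b ≠ a}, {y | fibGerm hφ E y b.1 = ggm φ _ y t} := by
      ext y
      simp only [Set.mem_compl_iff, Set.mem_iUnion]
      constructor
      · intro hy
        obtain ⟨b, hb⟩ := (fibGerm hφ E y).surjective (ggm φ _ y t)
        refine ⟨⟨b, ?_⟩, hb⟩
        rintro rfl
        exact hy hb
      · rintro ⟨⟨b, hb⟩, h⟩ h'
        exact hb ((fibGerm hφ E y).injective (Eq.trans h (Eq.symm h')))
    rw [this]
    exact isOpen_iUnion fun b => isOpen_fibGerm_eq hφ t b.1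
  exact Set.eq_univ_iff_forall.1 (h1.eq_univ ⟨y, h⟩) z

lemma exists_ggm_eq_fibGerm (a : E) :
    ∃ t : (globalSections k φ).obj ((associatedSheaf k hφ).obj E),
      ∀ y, fibGerm hφ E y a = ggm φ _ y t := by
  -- The constant family of germs with value `a` is locally realized by a pulled back section; these
  -- local sections then glue.
  have h1 (y : Y) : ∃ (V : Opens Y) (_ : y ∈ V) (t : Sec (inv φ ((associatedSheaf k hφ).obj E)) V),
      ∀ z (hz : z ∈ V), fibGerm hφ E z a = gm _ z hz t := by
    obtain ⟨U, hU, s, hs⟩ := exists_gm_pb _ (fibGerm hφ E y a)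
    have h2 := (fibGerm_eq_iff hφ E hU s a).1 hs.symm
    obtain ⟨W, hWs, hW, hyW⟩ := eventually_nhds_iff.1 (eventually_val_eq hφ s hU h2)
    refine ⟨⟨W, hW⟩ ⊓ (Opens.map φ).obj U, ⟨hyW, hU⟩,
      res _ (U := (Opens.map φ).obj U) inf_le_right (pb φ _ U s), fun z hz => ?_⟩
    refine .trans ?_ (gm_res _ (U := (Opens.map φ).obj U) inf_le_right hz _).symm
    exact (fibGerm_eq_iff hφ E hz.2 s a).2 (hWs z hz.1 hz.2)
  choose V hV t ht using h1
  obtain ⟨T, hT⟩ := exists_glue (F := inv φ ((associatedSheaf k hφ).obj E)) V ⊤ (fun _ => le_top)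
    (fun y _ => ⟨y, hV y⟩) t fun i j z hi hj => (ht i z hi).symm.trans (ht j z hj)
  refine ⟨T, fun y => (ht y y (hV y)).trans ?_⟩
  rw [← hT y]
  exact gm_res _ (U := ⊤) le_top (hV y) T

/-- The isomorphism between `E` and the global sections of the inverse image of the associated
sheaf. -/
lemma exists_unitEquiv : ∃ u : (globalSections k φ).obj ((associatedSheaf k hφ).obj E) ≃ₗ[k] E,
    ∀ t y, fibGerm hφ E y (u t) = ggm φ _ y t := by
  obtain ⟨y₀⟩ := hφ.isSimplyConn.1.toNonempty
  let u := (fibGerm hφ E y₀).symm.toLinearMap ∘ₗ ggm φ ((associatedSheaf k hφ).obj E) y₀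
  have hu (t) (y) : fibGerm hφ E y (u t) = ggm φ _ y t :=
    fibGerm_eq hφ t ((fibGerm hφ E y₀).apply_symm_apply _) y
  refine ⟨LinearEquiv.ofBijective u ⟨fun s t h => ggm_ext fun y => ?_, fun a => ?_⟩, hu⟩
  · rw [← hu, ← hu, h]
  · obtain ⟨t, ht⟩ := exists_ggm_eq_fibGerm hφ E a
    exact ⟨t, (fibGerm hφ E y₀).injective ((hu t y₀).trans (ht y₀).symm)⟩

/-- The isomorphism between `E` and the global sections of the inverse image of the associated
sheaf. -/
def unitEquiv : (globalSections k φ).obj ((associatedSheaf k hφ).obj E) ≃ₗ[k] E :=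
  (exists_unitEquiv hφ E).choose

lemma fibGerm_unitEquiv (t : (globalSections k φ).obj ((associatedSheaf k hφ).obj E)) (y : Y) :
    fibGerm hφ E y (unitEquiv hφ E t) = ggm φ _ y t :=
  (exists_unitEquiv hφ E).choose_spec t y

/-- Germs are compared at `g y`: the local section `s` representing `t` at `y` also represents `g t`
at `g y`, and its value `[y, e]` equals `[g y, g e]`. -/
lemma unitEquiv_ρ (g : Deck φ) (t : (globalSections k φ).obj ((associatedSheaf k hφ).obj E)) :
    unitEquiv hφ E (((globalSections k φ).obj _).ρ g t) = E.ρ g (unitEquiv hφ E t) := by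
  obtain ⟨y⟩ := hφ.isSimplyConn.1.toNonempty
  refine (fibGerm hφ E (g • y)).injective ?_
  rw [fibGerm_unitEquiv]
  obtain ⟨U, hU, s, hs⟩ := exists_gm_pb _ (ggm φ _ y t)
  have hgU : φ (g • y) ∈ U := by rwa [map_smul_eq]
  rw [ggm_ρ g hU hgU hs.symm]
  symm
  rw [fibGerm_eq_iff]
  have h1 := (fibGerm_eq_iff hφ E hU s _).1 ((fibGerm_unitEquiv hφ E t y).trans hs.symm)
  -- The point is generalized because the fibres over `φ (g • y)` and `φ y` are different types.
  have h2 : ∀ (x : X) (hx : x ∈ U) (h : x = φ y), val hφ E s ⟨x, hx⟩ =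
      fibLinearEquiv hφ E y h.symm (unitEquiv hφ E t) := by
    rintro _ _ rfl; exact h1
  rw [h2 _ hgU (map_smul_eq g y)]
  exact (fibLinearEquiv_smul hφ E g y _ rfl _).symm

variable {E} in
lemma unitEquiv_naturality {E' : Rep.{u} k (Deck φ)} (f : E ⟶ E')
    (t : (globalSections k φ).obj ((associatedSheaf k hφ).obj E)) :
    unitEquiv hφ E' (((globalSections k φ).map ((associatedSheaf k hφ).map f)).hom t) =
      f.hom (unitEquiv hφ E t) := by
  obtain ⟨y⟩ := hφ.isSimplyConn.1.toNonempty
  refine (fibGerm hφ E' y).injective ?_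
  rw [fibGerm_unitEquiv, ggm_map]
  obtain ⟨U, hU, s, hs⟩ := exists_gm_pb _ (ggm φ _ y t)
  rw [← hs, stMap_gm_pb]
  symm
  rw [fibGerm_eq_iff, val_ap, (fibGerm_eq_iff hφ E hU s _).1 ((fibGerm_unitEquiv hφ E t y).trans hs.symm)]
  rfl

/-- The isomorphism of representations between `E` and the global sections of the inverse image of
the associated sheaf. -/
def unitIso : (globalSections k φ).obj ((associatedSheaf k hφ).obj E) ≅ E :=
  Rep.mkIso (ρ := ((globalSections k φ).obj ((associatedSheaf k hφ).obj E)).ρ) (σ := E.ρ)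
    { unitEquiv hφ E with
      isIntertwining' := fun g => LinearMap.ext fun t => unitEquiv_ρ hφ E g t }

end Unit

/-! ### The equivalence -/

section Equivalence

variable {k : Type u} [Ring k] {Y X : TopCat.{u}} {φ : Y ⟶ X} (hφ : IsUniversalCovering φ)

/-- The associated sheaf, as a functor to quasi-coherent sheaves. -/
def associatedQcoh : Rep.{u} k (Deck φ) ⥤ Qcoh k X :=
  (isQuasicoherent k X).lift (associatedSheaf k hφ) fun E =>
    (isLC_associatedSheaf hφ E).isQuasicoherent

/-- Quasi-coherent sheaves on `X` are equivalent to representations of `Aut_X Y`. -/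
def qcohEquiv [LocallyConnectedSpace X] : Qcoh k X ≌ Rep.{u} k (Deck φ) :=
  CategoryTheory.Equivalence.mk ((isQuasicoherent k X).ι ⋙ globalSections k φ) (associatedQcoh hφ)
    (NatIso.ofComponents
      (fun L => (isQuasicoherent k X).isoMk
        (@asIso _ _ _ _ _ (isIso_toAssociated hφ (isLC_of_isQuasicoherent L.2))))
      (fun f => ObjectProperty.hom_ext _
        (toAssociated_naturality hφ _ _ f.hom)))
    (NatIso.ofComponents (fun E => unitIso hφ E)
      (fun f => Rep.hom_ext (Representation.IntertwiningMap.ext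
        (LinearMap.ext fun t => unitEquiv_naturality hφ f t))))

end Equivalence

end QcohRep

end

theorem mainTheorem6 (k : Type u) [Ring k] (X Y : TopCat.{u}) [ConnectedSpace X]
    (hX : QcohRep.IsLocallySimplyConn X) (φ : Y ⟶ X) (hφ : QcohRep.IsUniversalCovering φ) :
    ∃ e : QcohRep.Qcoh k X ≌ Rep.{u} k (QcohRep.Deck φ),
      Nonempty (e.functor ≅
        (QcohRep.isQuasicoherent k X).ι ⋙ QcohRep.globalSections k φ) ∧
      Nonempty (e.inverse ⋙ (QcohRep.isQuasicoherent k X).ι ≅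
        QcohRep.associatedSheaf k hφ) := by
  have := hX.locallyConnectedSpace
  -- The equivalence is built from the two prescribed functors, so both comparisons are identities.
  exact ⟨QcohRep.qcohEquiv hφ, ⟨Iso.refl _⟩, ⟨Iso.refl _⟩⟩
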